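/- Let $R$ be a Cohen–Macaulay (Noetherian commutative) local ring; all modules are finitely generated. Let $K$ be a semidualizing $R$-module, i.e. the homothety map $R\to\operatorname{Hom}_R(K,K)$ is an isomorphism and $\operatorname{Ext}^i_R(K,K)=0$ for all $i>0$. A module $G$ is totally $K$-reflexive if the evaluation map $G\to\operatorname{Hom}_R(\operatorname{Hom}_R(G,K),K)$ is bijective and $\operatorname{Ext}^i_R(G,K)=0=\operatorname{Ext}^i_R(\operatorname{Hom}_R(G,K),K)$ for all $i>0$. The $G_K$-dimension $\mathrm{G}_K\text{-}\dim_R M$ is the least length of a resolution of $M$ by totally $K$-reflexive modules ($\infty$ if there is no finite one), and $\operatorname{grade}_R M=\inf\{i\mid \operatorname{Ext}^i_R(M,R)\neq 0\}$. For $n\ge 0$ let $\mathcal X_n$ be the class of $G_K$-perfect modules of grade $n$, i.e. of modules $X$ with $\operatorname{grade}_R X=\mathrm{G}_K\text{-}\dim_R X=n$. Let $\operatorname{Epi}(\mathcal X_n)$ be the class of epimorphisms $\phi:X\twoheadrightarrow M$ with $X\in\mathcal X_n$ and $\operatorname{grade}_R M=\operatorname{grade}_R X$. For such $\phi$, with $j:\ker\phi\hookrightarrow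 X$ the inclusion, let $L_K^n(\phi):\operatorname{Ext}^n_R(X,K)\twoheadrightarrow\operatorname{im}\operatorname{Ext}^n_R(j,K)$ be the epimorphism induced by $\operatorname{Ext}^n_R(j,K)$. Two epimorphisms $\phi:X\twoheadrightarrow M$ and $\psi:Y\twoheadrightarrow N$ are equivalent, $\phi\equiv\psi$, if there are isomorphisms $\alpha:M\to N$ and $\beta:X\to Y$ with $\alpha\phi=\psi\beta$. Modules $M,N$ are directly linked with respect to $\mathcal X_n$ if there are $\phi:X\twoheadrightarrow M$ and $\psi:Y\twoheadrightarrow N$ in $\operatorname{Epi}(\mathcal X_n)$ with $\phi\equiv L_K^n(\psi)$ and $\psi\equiv L_K^n(\phi)$; they are linked in $m$ steps if there are modules $M=N_0,N_1,\dots,N_m=N$ such that $N_i$ and $N_{i+1}$ are directly linked for $0\le i<m$. A module $M$ is reduced $G_K$-perfect if $\mathrm{G}_K\text{-}\dim_R M<\infty$ and $\operatorname{Ext}^i_R(M,K)=0$ for all $i\neq\operatorname{grade}_R M,\ \mathrm{G}_K\text{-}\dim_R M$. **Theorem.** Let $n\ge 0$ and let $M$, $N$ be $R$-modules which are linked in an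 odd number of steps with respect to $\mathcal X_n$. If $M$ is reduced $G_K$-perfect, then $$\operatorname{depth}_R M+\operatorname{depth}_R N=\dim_R M+\operatorname{depth}_R\operatorname{Ext}^{t}_R(M,K),\qquad t=\mathrm{G}_K\text{-}\dim_R M .$$ -/

import Mathlib

open CategoryTheory CategoryTheory.Abelian

universe u

namespace ModuleLinkage

noncomputable section

variable {R : Type u} [CommRing R]

/-- The map `Ext^n(f, K) : Ext^n(B, K) → Ext^n(A, K)` induced by `f : A ⟶ B`. -/
def extMap (K : ModuleCat.{u} R) (n : ℕ) {A B : ModuleCat.{u} R} (f : A ⟶ B) :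
    Ext B K n →ₗ[R] Ext A K n :=
  (Ext.mk₀ f).precompOfLinear R K (zero_add n)

/-- The grade of a module, `inf {i | Ext^i(M, R) ≠ 0}` (it is `⊤` for the zero module). -/
def grade (M : ModuleCat.{u} R) : ℕ∞ :=
  ⨅ (i : ℕ) (_ : Nontrivial (Ext M (ModuleCat.of R R) i)), (i : ℕ∞)

/-- The depth of a finitely generated module over a local ring: the supremum of the lengths of
the `M`-regular sequences in the maximal ideal. For `M ≠ 0` weakly regular sequences in the
maximal ideal are regular by Nakayama's lemma; the depth of the zero module is `⊤`. -/
def depth [IsLocalRing R] (M : ModuleCat.{u} R) : ℕ∞ :=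
  ⨆ (rs : List R) (_ : (∀ r ∈ rs, r ∈ IsLocalRing.maximalIdeal R) ∧
    RingTheory.Sequence.IsWeaklyRegular M rs), (rs.length : ℕ∞)

/-- A Noetherian local ring is Cohen-Macaulay if its depth equals its Krull dimension. -/
class IsCohenMacaulayLocalRing (R : Type u) [CommRing R] : Prop extends
    IsNoetherianRing R, IsLocalRing R where
  depth_eq_dim : ((depth (ModuleCat.of R R) : ℕ∞) : WithBot ℕ∞) = ringKrullDim R

/-- Semidualizing modules: finitely generated, the homothety map `R → Hom(K, K)` is bijective
and `Ext^i(K, K) = 0` for `i > 0`. -/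
structure IsSemidualizing (K : ModuleCat.{u} R) : Prop where
  finite : Module.Finite R K
  bijective_homothety : Function.Bijective (LinearMap.lsmul R K)
  ext_eq_zero : ∀ i : ℕ, 0 < i → Subsingleton (Ext K K i)

/-- Totally `K`-reflexive modules. The map `(LinearMap.id : Hom(M, K) → Hom(M, K)).flip` is the
evaluation map `M → Hom(Hom(M, K), K)`, `m ↦ (f ↦ f m)`. -/
structure IsTotallyReflexive (K M : ModuleCat.{u} R) : Prop where
  finite : Module.Finite R M
  bijective_eval :
    Function.Bijective ((LinearMap.id : (M →ₗ[R] K) →ₗ[R] (M →ₗ[R] K)).flip)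
  ext_eq_zero : ∀ i : ℕ, 0 < i → Subsingleton (Ext M K i)
  ext_dual_eq_zero : ∀ i : ℕ, 0 < i → Subsingleton (Ext (ModuleCat.of R (M →ₗ[R] K)) K i)

/-- A resolution `⋯ → G 1 → G 0 → M → 0` of `M` by totally `K`-reflexive modules. -/
structure GKResolution (K M : ModuleCat.{u} R) where
  G : ℕ → ModuleCat.{u} R
  d : ∀ i, G (i + 1) →ₗ[R] G i
  aug : G 0 →ₗ[R] M
  isTotallyReflexive : ∀ i, IsTotallyReflexive K (G i)
  surjective_aug : Function.Surjective aug
  exact_aug : Function.Exact (d 0) aug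
  exact_d : ∀ i, Function.Exact (d (i + 1)) (d i)

/-- The resolution has length at most `n`. -/
def GKResolution.LengthLE {K M : ModuleCat.{u} R} (P : GKResolution K M) (n : ℕ) : Prop :=
  ∀ i, n < i → Subsingleton (P.G i)

/-- The `G_K`-dimension: the least length of a resolution by totally `K`-reflexive modules,
`⊤` if there is no resolution of finite length. -/
def gkDim (K M : ModuleCat.{u} R) : ℕ∞ :=
  ⨅ (n : ℕ) (_ : ∃ P : GKResolution K M, P.LengthLE n), (n : ℕ∞)

/-- The subcategory of the `G_K`-perfect modules of grade `n`: finitely generated modules whose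
grade and `G_K`-dimension are both `n`. -/
def gkPerfect (K : ModuleCat.{u} R) (n : ℕ) : ObjectProperty (ModuleCat.{u} R) :=
  fun M => Module.Finite R M ∧ grade M = n ∧ gkDim K M = grade M

/-- Reduced `G_K`-perfect modules. -/
structure IsReducedGKPerfect (K M : ModuleCat.{u} R) : Prop where
  finite : Module.Finite R M
  gkDim_ne_top : gkDim K M ≠ ⊤
  ext_eq_zero : ∀ i : ℕ, (i : ℕ∞) ≠ grade M → (i : ℕ∞) ≠ gkDim K M → Subsingleton (Ext M K i)

/-- The class `Epi(𝒳)` of the epimorphisms `φ : X ↠ M` with `X` in `𝒳`, `M` finitely generated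
and `grade M = grade X`. -/
structure IsReflexiveHom (𝒳 : ObjectProperty (ModuleCat.{u} R)) {X M : ModuleCat.{u} R}
    (φ : X ⟶ M) : Prop where
  prop_source : 𝒳 X
  finite_target : Module.Finite R M
  surjective : Function.Surjective φ.hom
  grade_eq : grade M = grade X

/-- Equivalence of homomorphisms: isomorphisms of the sources and of the targets that form a
commutative square. -/
def HomEquivalent {X M Y N : ModuleCat.{u} R} (φ : X ⟶ M) (ψ : Y ⟶ N) : Prop :=
  ∃ (α : M ≅ N) (β : X ≅ Y), φ ≫ α.hom = β.hom ≫ ψ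

/-- The map `Ext^n(j, K) : Ext^n(X, K) → Ext^n(ker φ, K)` induced by the inclusion
`j : ker φ → X`. -/
def extKer (K : ModuleCat.{u} R) (n : ℕ) {X M : ModuleCat.{u} R} (φ : X ⟶ M) :
    Ext X K n →ₗ[R] Ext (ModuleCat.of R (LinearMap.ker φ.hom)) K n :=
  extMap K n (ModuleCat.ofHom (LinearMap.ker φ.hom).subtype)

/-- The homomorphism `L_K^n(φ) : Ext^n(X, K) ↠ im Ext^n(j, K)` induced by `Ext^n(j, K)`. -/
def linkHom (K : ModuleCat.{u} R) (n : ℕ) {X M : ModuleCat.{u} R} (φ : X ⟶ M) :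
    ModuleCat.of R (Ext X K n) ⟶ ModuleCat.of R (LinearMap.range (extKer K n φ)) :=
  ModuleCat.ofHom (extKer K n φ).rangeRestrict

/-- `M` and `N` are directly linked with respect to `𝒳`: there are `φ : X ↠ M` and `ψ : Y ↠ N`
in `Epi(𝒳)` with `φ ≡ L_K^n(ψ)` and `ψ ≡ L_K^n(φ)`. -/
def DirectlyLinked (K : ModuleCat.{u} R) (n : ℕ) (𝒳 : ObjectProperty (ModuleCat.{u} R))
    (M N : ModuleCat.{u} R) : Prop :=
  ∃ (X Y : ModuleCat.{u} R) (φ : X ⟶ M) (ψ : Y ⟶ N),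
    IsReflexiveHom 𝒳 φ ∧ IsReflexiveHom 𝒳 ψ ∧
      HomEquivalent φ (linkHom K n ψ) ∧ HomEquivalent ψ (linkHom K n φ)

/-- `M` and `N` are linked in `m` steps with respect to `𝒳` (of interest for `m > 0`). -/
def LinkedInSteps (K : ModuleCat.{u} R) (n : ℕ) (𝒳 : ObjectProperty (ModuleCat.{u} R)) (m : ℕ)
    (M N : ModuleCat.{u} R) : Prop :=
  ∃ c : ℕ → ModuleCat.{u} R, c 0 = M ∧ c m = N ∧
    ∀ i < m, DirectlyLinked K n 𝒳 (c i) (c (i + 1))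

end

end ModuleLinkage

namespace ModuleLinkage

variable {R : Type u} [CommRing R]

/-! ### Vanishing of `Ext` and long exact sequences -/

/-! Put d = dim R and b = d - n. If Ext^i(L, R) = 0 for i < n, then also Ext^i(L, K) = 0 for i < n
(`IsSemidualizing.ext_subsingleton`), so the annihilator of L contains a sequence of length n that
is weakly regular on both R and K. Let J be the ideal it generates and K' = K/JK. On modules killed
by J the functor Ext^n(-, K) is Hom(-, K') (`exists_isRelDual`). A direct link given by φ : X → M
and ψ : Y → N thus turns into ordinary duality: N is the image of Hom(X, K') → Hom(ker φ, K').

Write * for Hom(-, K'). In such a link X is K'-reflexive and M is K'-torsionless, so ker φ ≅ N*.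
Hence Ext^{n+1}(M, K) is the cokernel of N → N**, and Ext^{i+1}(M, K) ≅ Ext^i(N*, K) for i > n
(`IsRelDual.link_equiv`). The right-hand sides depend on N alone, so modules an even number of links
apart share Ext^i(-, K) for all i > n. An odd chain therefore ends in a direct link from some M' to
N, where M' has the same higher Ext modules as M.

Above degree n, only Ext^t(M', K) can be nonzero. If t > n, dualizing syzygies over R/J into K',
which has depth at least b, gives depth N = depth Ext^t(M, K) + (t - n)
(`IsRelDual.depth_range_dualMap`); this needs the bound depth Ext^t(M, K) ≤ d - t. If t = n, then N
and Ext^n(M, K) both have depth b. The formula follows from dim M = d - n and the Auslander-Bridger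
equality depth M = d - t. That equality and the depth bound both rest on
`GKLe.linearMap_ext_eq_zero`. -/

theorem ext_subsingleton_of_iso_left {A B : ModuleCat.{u} R} (e : A ≅ B) (K : ModuleCat.{u} R)
    (i : ℕ) (h : Subsingleton (Ext B K i)) : Subsingleton (Ext A K i) := by
  refine subsingleton_of_forall_eq 0 fun x => ?_
  have : x = (Ext.mk₀ e.hom).comp ((Ext.mk₀ e.inv).comp x (zero_add i)) (zero_add i) := by simp
  rw [this, Subsingleton.elim ((Ext.mk₀ e.inv).comp x (zero_add i)) 0, Ext.comp_zero]

theorem ext_subsingleton_of_iso_right {A B : ModuleCat.{u} R} (e : A ≅ B) (L : ModuleCat.{u} R)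
    (i : ℕ) (h : Subsingleton (Ext L B i)) : Subsingleton (Ext L A i) := by
  refine subsingleton_of_forall_eq 0 fun x => ?_
  have : x = (x.comp (Ext.mk₀ e.hom) (add_zero i)).comp (Ext.mk₀ e.inv) (add_zero i) := by simp
  rw [this, Subsingleton.elim (x.comp (Ext.mk₀ e.hom) (add_zero i)) 0, Ext.zero_comp]

theorem ext_subsingleton_of_subsingleton_left (A K : ModuleCat.{u} R) [Subsingleton A] (i : ℕ) :
    Subsingleton (Ext A K i) := by
  refine subsingleton_of_forall_eq 0 fun x => ?_
  have h : 𝟙 A = 0 := by ext a; exact Subsingleton.elim _ _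
  rw [← Ext.mk₀_id_comp x, h, Ext.mk₀_zero, Ext.zero_comp]

theorem ext_subsingleton_of_subsingleton_right (L A : ModuleCat.{u} R) [Subsingleton A] (i : ℕ) :
    Subsingleton (Ext L A i) := by
  refine subsingleton_of_forall_eq 0 fun x => ?_
  have h : 𝟙 A = 0 := by ext a; exact Subsingleton.elim _ _
  rw [← Ext.comp_mk₀_id x, h, Ext.mk₀_zero, Ext.comp_zero]

theorem ext_zero_subsingleton_iff (A B : ModuleCat.{u} R) :
    Subsingleton (Ext A B 0) ↔ Subsingleton (A →ₗ[R] B) :=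
  (Ext.addEquiv₀.trans ModuleCat.homAddEquiv).toEquiv.subsingleton_congr

/-- Isomorphic modules have isomorphic `Ext` in the first variable. -/
noncomputable def extCongrLeft {A B : ModuleCat.{u} R} (e : A ≅ B) (K : ModuleCat.{u} R) (i : ℕ) :
    Ext A K i ≃ₗ[R] Ext B K i :=
  LinearEquiv.ofLinearMap (extMap K i e.inv) (extMap K i e.hom)
    (by ext x; simp [extMap]) (by ext x; simp [extMap])

theorem ext_zero_subsingleton_of_injective (L : ModuleCat.{u} R) {A B : ModuleCat.{u} R}
    (f : A →ₗ[R] B) (hf : Function.Injective f) (h : Subsingleton (Ext L B 0)) :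
    Subsingleton (Ext L A 0) := by
  rw [ext_zero_subsingleton_iff] at h ⊢
  exact ⟨fun a b => LinearMap.ext fun x => hf congr($(Subsingleton.elim (f ∘ₗ a) (f ∘ₗ b)) x)⟩

section LES

variable {S : ShortComplex (ModuleCat.{u} R)} (hS : S.ShortExact)
include hS

theorem ext_succ_subsingleton_X₁ (L : ModuleCat.{u} R) (i : ℕ)
    (h₃ : Subsingleton (Ext L S.X₃ i)) (h₂ : Subsingleton (Ext L S.X₂ (i + 1))) :
    Subsingleton (Ext L S.X₁ (i + 1)) := by
  refine subsingleton_of_forall_eq 0 fun x => ?_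
  obtain ⟨y, rfl⟩ := Ext.covariant_sequence_exact₁ L hS x (Subsingleton.elim _ _) rfl
  rw [Subsingleton.elim y 0, Ext.zero_comp]

theorem ext_subsingleton_X₃ (L : ModuleCat.{u} R) (i : ℕ)
    (h₂ : Subsingleton (Ext L S.X₂ i)) (h₁ : Subsingleton (Ext L S.X₁ (i + 1))) :
    Subsingleton (Ext L S.X₃ i) := by
  refine subsingleton_of_forall_eq 0 fun x => ?_
  obtain ⟨y, rfl⟩ := Ext.covariant_sequence_exact₃ L hS x rfl (Subsingleton.elim _ _)
  rw [Subsingleton.elim y 0, Ext.zero_comp]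

/-- The hypothesis reads `j + 1 = i` so that it is empty in degree 0, where injectivity comes from
`S.f` being a monomorphism. -/
theorem ext_postcomp_injective (L : ModuleCat.{u} R) (i : ℕ)
    (h : ∀ j, j + 1 = i → Subsingleton (Ext L S.X₃ j)) (x : Ext L S.X₁ i)
    (hx : x.comp (Ext.mk₀ S.f) (add_zero i) = 0) : x = 0 := by
  cases i with
  | zero =>
    have := hS.mono_f
    exact Ext.postcomp_mk₀_injective_of_mono L S.f (by simpa using hx)
  | succ i =>
    have := h i rfl
    obtain ⟨y, rfl⟩ := Ext.covariant_sequence_exact₁ L hS x hx rfl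
    rw [Subsingleton.elim y 0, Ext.zero_comp]

theorem ext_succ_left_subsingleton_X₃ (K : ModuleCat.{u} R) (i : ℕ)
    (h₁ : Subsingleton (Ext S.X₁ K i)) (h₂ : Subsingleton (Ext S.X₂ K (i + 1))) :
    Subsingleton (Ext S.X₃ K (i + 1)) := by
  refine subsingleton_of_forall_eq 0 fun x => ?_
  obtain ⟨y, rfl⟩ := Ext.contravariant_sequence_exact₃ hS K x (Subsingleton.elim _ _)
    (add_comm 1 i)
  rw [Subsingleton.elim y 0, Ext.comp_zero]

theorem ext_left_subsingleton_X₂ (K : ModuleCat.{u} R) (i : ℕ)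
    (h₁ : Subsingleton (Ext S.X₁ K i)) (h₃ : Subsingleton (Ext S.X₃ K i)) :
    Subsingleton (Ext S.X₂ K i) := by
  refine subsingleton_of_forall_eq 0 fun x => ?_
  obtain ⟨y, rfl⟩ := Ext.contravariant_sequence_exact₂ hS K x (Subsingleton.elim _ _)
  rw [Subsingleton.elim y 0, Ext.comp_zero]

theorem ext_left_subsingleton_X₁ (K : ModuleCat.{u} R) (i : ℕ)
    (h₂ : Subsingleton (Ext S.X₂ K i)) (h₃ : Subsingleton (Ext S.X₃ K (i + 1))) :
    Subsingleton (Ext S.X₁ K i) := by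
  refine subsingleton_of_forall_eq 0 fun x => ?_
  obtain ⟨y, rfl⟩ := Ext.contravariant_sequence_exact₁ hS K x (add_comm 1 i)
    (Subsingleton.elim _ _)
  rw [Subsingleton.elim y 0, Ext.comp_zero]

theorem precomp_extClass_surjective (K : ModuleCat.{u} R) (i : ℕ)
    (h : Subsingleton (Ext S.X₂ K (i + 1))) :
    Function.Surjective (hS.extClass.precompOfLinear R K (add_comm 1 i)) := fun x =>
  Ext.contravariant_sequence_exact₃ hS K x (Subsingleton.elim _ _) (add_comm 1 i)

theorem ker_precomp_extClass (K : ModuleCat.{u} R) (i : ℕ) :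
    LinearMap.ker (hS.extClass.precompOfLinear R K (add_comm 1 i)) =
      LinearMap.range (extMap K i S.f) := by
  ext x
  refine ⟨fun h => Ext.contravariant_sequence_exact₁ hS K x (add_comm 1 i) h, ?_⟩
  rintro ⟨y, rfl⟩
  simp [extMap]

/-- Dimension shifting in the first variable of `Ext`. -/
noncomputable def extShift (K : ModuleCat.{u} R) (i : ℕ)
    (h : Subsingleton (Ext S.X₂ K i)) (h' : Subsingleton (Ext S.X₂ K (i + 1))) :
    Ext S.X₁ K i ≃ₗ[R] Ext S.X₃ K (i + 1) :=
  LinearEquiv.ofBijective (hS.extClass.precompOfLinear R K (add_comm 1 i))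
    ⟨by
      rw [← LinearMap.ker_eq_bot, ker_precomp_extClass hS, LinearMap.range_eq_bot]
      ext x; simp [Subsingleton.elim x 0], precomp_extClass_surjective hS K i h'⟩

/-- The connecting map identifies the cokernel of `Ext^i(X₂, K) → Ext^i(X₁, K)` with
`Ext^{i+1}(X₃, K)` when `Ext^{i+1}(X₂, K) = 0`. -/
noncomputable def extCokernelEquiv (K : ModuleCat.{u} R) (i : ℕ)
    (h : Subsingleton (Ext S.X₂ K (i + 1))) :
    (Ext S.X₁ K i ⧸ LinearMap.range (extMap K i S.f)) ≃ₗ[R] Ext S.X₃ K (i + 1) :=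
  (Submodule.quotEquivOfEq _ _ (ker_precomp_extClass hS K i).symm).trans
    (LinearMap.quotKerEquivOfSurjective _ (precomp_extClass_surjective hS K i h))

end LES

/-- A short exact sequence of modules as a short complex in `ModuleCat`. -/
def sesOf {A B C : ModuleCat.{u} R} (f : A →ₗ[R] B) (g : B →ₗ[R] C) (h : Function.Exact f g) :
    ShortComplex (ModuleCat.{u} R) :=
  ShortComplex.mk (ModuleCat.ofHom f) (ModuleCat.ofHom g) (by
    ext x; exact h.apply_apply_eq_zero x)

theorem sesOf_shortExact {A B C : ModuleCat.{u} R} (f : A →ₗ[R] B) (g : B →ₗ[R] C)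
    (h : Function.Exact f g) (hf : Function.Injective f) (hg : Function.Surjective g) :
    (sesOf f g h).ShortExact where
  exact := (ShortComplex.ShortExact.moduleCat_exact_iff_function_exact _).2 h
  mono_f := (ModuleCat.mono_iff_injective _).2 hf
  epi_g := (ModuleCat.epi_iff_surjective _).2 hg

theorem exact_of_shortExact {S : ShortComplex (ModuleCat.{u} R)} (hS : S.ShortExact) :
    Function.Exact S.f.hom S.g.hom :=
  (ShortComplex.ShortExact.moduleCat_exact_iff_function_exact _).1 hS.exact

theorem finite_X₁ [IsNoetherianRing R] {S : ShortComplex (ModuleCat.{u} R)} (hS : S.ShortExact)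
    [Module.Finite R S.X₂] : Module.Finite R S.X₁ :=
  Module.Finite.of_injective S.f.hom hS.moduleCat_injective_f

theorem finite_X₃ {S : ShortComplex (ModuleCat.{u} R)} (hS : S.ShortExact)
    [Module.Finite R S.X₂] : Module.Finite R S.X₃ :=
  Module.Finite.of_surjective S.g.hom hS.moduleCat_surjective_g

/-! ### Finite products and products of two modules -/

theorem pi_id_eq_sum {b : ℕ} (M : ModuleCat.{u} R) :
    (𝟙 (ModuleCat.of R (Fin b → M))) = ∑ i : Fin b,
      ModuleCat.ofHom (LinearMap.proj i : (Fin b → M) →ₗ[R] M) ≫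
        ModuleCat.ofHom (LinearMap.single R (fun _ : Fin b => (M : Type u)) i) := by
  ext x j
  simp [ModuleCat.hom_sum, Finset.sum_apply, Pi.single_apply]

theorem ext_pi_right_subsingleton (L M : ModuleCat.{u} R) (b i : ℕ)
    (h : Subsingleton (Ext L M i)) : Subsingleton (Ext L (ModuleCat.of R (Fin b → M)) i) := by
  refine subsingleton_of_forall_eq 0 fun x => ?_
  rw [← Ext.comp_mk₀_id x, pi_id_eq_sum, Ext.mk₀_sum, Ext.comp_sum]
  refine Finset.sum_eq_zero fun j _ => ?_
  rw [← Ext.mk₀_comp_mk₀, ← Ext.comp_assoc_of_third_deg_zero,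
    Subsingleton.elim (x.comp (Ext.mk₀ (ModuleCat.ofHom (LinearMap.proj j))) (add_zero i)) 0,
    Ext.zero_comp]

theorem ext_pi_left_subsingleton (M K : ModuleCat.{u} R) (b i : ℕ)
    (h : Subsingleton (Ext M K i)) : Subsingleton (Ext (ModuleCat.of R (Fin b → M)) K i) := by
  refine subsingleton_of_forall_eq 0 fun x => ?_
  rw [← Ext.mk₀_id_comp x, pi_id_eq_sum, Ext.mk₀_sum, Ext.sum_comp]
  refine Finset.sum_eq_zero fun j _ => ?_
  rw [← Ext.mk₀_comp_mk₀_assoc, Subsingleton.elim ((Ext.mk₀ (ModuleCat.ofHom (LinearMap.single R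
    (fun _ : Fin b => (M : Type u)) j))).comp x (zero_add i)) 0, Ext.comp_zero]

theorem ext_prod_left_subsingleton (A B K : ModuleCat.{u} R) (i : ℕ)
    (hA : Subsingleton (Ext A K i)) (hB : Subsingleton (Ext B K i)) :
    Subsingleton (Ext (ModuleCat.of R (A × B)) K i) :=
  ext_left_subsingleton_X₂ (sesOf_shortExact (A := A) (B := ModuleCat.of R (A × B)) (C := B)
    (LinearMap.inl R A B) (LinearMap.snd R A B) (Function.Exact.inl_snd)
    LinearMap.inl_injective LinearMap.snd_surjective) K i hA hB

theorem mk₀_smul_id_comp {A K : ModuleCat.{u} R} (r : R) (i : ℕ) (x : Ext A K i) :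
    (Ext.mk₀ (r • 𝟙 A)).comp x (zero_add i) = r • x := by
  rw [Ext.mk₀_smul, Ext.smul_comp, Ext.mk₀_id_comp]

theorem comp_mk₀_smul_id {A K : ModuleCat.{u} R} (r : R) (i : ℕ) (x : Ext A K i) :
    x.comp (Ext.mk₀ (r • 𝟙 K)) (add_zero i) = r • x := by
  rw [Ext.mk₀_smul, Ext.comp_smul, Ext.comp_mk₀_id]

theorem ext_smul_eq_zero_of_mem_annihilator_left {A K : ModuleCat.{u} R} {r : R}
    (hr : r ∈ Module.annihilator R A) (i : ℕ) (x : Ext A K i) : r • x = 0 := by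
  have h : r • 𝟙 A = 0 := by ext a; exact Module.mem_annihilator.1 hr a
  rw [← mk₀_smul_id_comp, h, Ext.mk₀_zero, Ext.zero_comp]

end ModuleLinkage

namespace ModuleLinkage

variable {R : Type u} [CommRing R]

/-! ### Duality with respect to a relative dualizing module -/

/-- The dual `Hom(W, K)`. -/
abbrev dual (K W : ModuleCat.{u} R) : ModuleCat.{u} R := ModuleCat.of R (W →ₗ[R] K)

/-- The map `Hom(B, K) → Hom(A, K)` induced by `f : A → B`. -/
abbrev dualMap (K : ModuleCat.{u} R) {A B : ModuleCat.{u} R} (f : A →ₗ[R] B) :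
    dual K B →ₗ[R] dual K A := LinearMap.lcomp R K f

theorem dualMap_injective (K : ModuleCat.{u} R) {A B : ModuleCat.{u} R} (f : A →ₗ[R] B)
    (hf : Function.Surjective f) : Function.Injective (dualMap K f) := fun a b h => by
  ext x
  obtain ⟨y, rfl⟩ := hf x
  exact congr($h y)

theorem dualMap_exact (K : ModuleCat.{u} R) {A B C : ModuleCat.{u} R} (f : A →ₗ[R] B)
    (g : B →ₗ[R] C) (h : Function.Exact f g) (hg : Function.Surjective g) :
    Function.Exact (dualMap K g) (dualMap K f) := by
  intro φ
  constructor
  · intro hφ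
    have hker : LinearMap.ker g ≤ LinearMap.ker φ := by
      intro x hx
      obtain ⟨y, rfl⟩ := (h x).1 hx
      exact congr($hφ y)
    refine ⟨((LinearMap.ker g).liftQ φ hker).comp
      (g.quotKerEquivOfSurjective hg).symm.toLinearMap, ?_⟩
    ext x
    have : (g.quotKerEquivOfSurjective hg).symm (g x) = (LinearMap.ker g).mkQ x := by
      rw [LinearEquiv.symm_apply_eq]; rfl
    simp [this]
  · rintro ⟨ψ, rfl⟩
    ext x
    simp [h.apply_apply_eq_zero x]

/-- `θ ∈ Ext^n(K', K)` represents `Ext^n(-, K)` as `Hom(-, K')` on the modules that are killed by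
`J`, on which the lower `Ext^i(-, K)` vanish; moreover `Ext^i(R/J, K) = 0` for `i > n`. -/
structure IsRelDual (J : Ideal R) (n : ℕ) (K K' : ModuleCat.{u} R) (θ : Ext K' K n) : Prop where
  finite : Module.Finite R K'
  le_annihilator : J ≤ Module.annihilator R K'
  subsingleton : ∀ W : ModuleCat.{u} R, J ≤ Module.annihilator R W →
    ∀ i < n, Subsingleton (Ext W K i)
  bijective : ∀ W : ModuleCat.{u} R, J ≤ Module.annihilator R W →
    Function.Bijective (fun f : W →ₗ[R] K' =>
      (Ext.mk₀ (ModuleCat.ofHom f)).comp θ (zero_add n))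
  quotient : ∀ i, n < i → Subsingleton (Ext (ModuleCat.of R (R ⧸ J)) K i)

namespace IsRelDual

variable {J : Ideal R} {n : ℕ} {K K' : ModuleCat.{u} R} {θ : Ext K' K n}

/-- The isomorphism `Hom(W, K') ≃ Ext^n(W, K)` for `W` killed by `J`. -/
noncomputable def equiv (h : IsRelDual J n K K' θ) (W : ModuleCat.{u} R)
    (hW : J ≤ Module.annihilator R W) : dual K' W ≃ₗ[R] Ext W K n :=
  LinearEquiv.ofBijective
    { toFun := fun f : W →ₗ[R] K' => (Ext.mk₀ (ModuleCat.ofHom f)).comp θ (zero_add n)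
      map_add' := fun f g => by
        rw [ModuleCat.ofHom_add, Ext.mk₀_add, Ext.add_comp]
      map_smul' := fun r f => by
        have : ModuleCat.ofHom (r • f) = r • ModuleCat.ofHom f := rfl
        rw [this, Ext.mk₀_smul, Ext.smul_comp]; rfl } (h.bijective W hW)

theorem equiv_naturality (h : IsRelDual J n K K' θ) {A B : ModuleCat.{u} R}
    (hA : J ≤ Module.annihilator R A) (hB : J ≤ Module.annihilator R B) (f : A ⟶ B)
    (g : dual K' B) : extMap K n f (h.equiv B hB g) = h.equiv A hA (dualMap K' f.hom g) := by
  change (Ext.mk₀ f).comp ((Ext.mk₀ (ModuleCat.ofHom g)).comp θ (zero_add n)) (zero_add n) =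
    (Ext.mk₀ (ModuleCat.ofHom _)).comp θ (zero_add n)
  rw [Ext.mk₀_comp_mk₀_assoc]
  rfl

/-- The ranges of `Hom(f, K')` and `Ext^n(f, K)` correspond to each other. -/
theorem map_range (h : IsRelDual J n K K' θ) {A B : ModuleCat.{u} R}
    (hA : J ≤ Module.annihilator R A) (hB : J ≤ Module.annihilator R B) (f : A ⟶ B) :
    (LinearMap.range (dualMap K' f.hom)).map (h.equiv A hA).toLinearMap =
      LinearMap.range (extMap K n f) := by
  ext x
  constructor
  · rintro ⟨_, ⟨g, rfl⟩, rfl⟩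
    exact ⟨h.equiv B hB g, h.equiv_naturality hA hB f g⟩
  · rintro ⟨y, rfl⟩
    refine ⟨_, ⟨(h.equiv B hB).symm y, rfl⟩, ?_⟩
    rw [LinearEquiv.coe_coe, ← h.equiv_naturality hA hB f, LinearEquiv.apply_symm_apply]

theorem dualMap_surjective (h : IsRelDual J n K K' θ) {S : ShortComplex (ModuleCat.{u} R)}
    (hS : S.ShortExact) (h₁ : J ≤ Module.annihilator R S.X₁)
    (h₂ : J ≤ Module.annihilator R S.X₂) (h₃ : Subsingleton (Ext S.X₃ K (n + 1))) :
    Function.Surjective (dualMap K' S.f.hom) := by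
  intro y
  obtain ⟨x, hx⟩ := Ext.contravariant_sequence_exact₁ hS K (h.equiv S.X₁ h₁ y) (add_comm 1 n)
    (Subsingleton.elim _ _)
  refine ⟨(h.equiv S.X₂ h₂).symm x, (h.equiv S.X₁ h₁).injective ?_⟩
  rw [← h.equiv_naturality h₁ h₂ S.f, LinearEquiv.apply_symm_apply]
  exact hx

/-- `Ext^{n+1}(X₃, K)` is the cokernel of `Hom(X₂, K') → Hom(X₁, K')`. -/
noncomputable def cokernelEquiv (h : IsRelDual J n K K' θ) {S : ShortComplex (ModuleCat.{u} R)}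
    (hS : S.ShortExact) (h₁ : J ≤ Module.annihilator R S.X₁)
    (h₂ : J ≤ Module.annihilator R S.X₂) (hX : Subsingleton (Ext S.X₂ K (n + 1))) :
    (dual K' S.X₁ ⧸ LinearMap.range (dualMap K' S.f.hom)) ≃ₗ[R] Ext S.X₃ K (n + 1) :=
  (Submodule.Quotient.equiv _ _ (h.equiv S.X₁ h₁) (h.map_range h₁ h₂ S.f)).trans
    (extCokernelEquiv hS K n hX)

end IsRelDual

theorem le_annihilator_X₁ {J : Ideal R} {S : ShortComplex (ModuleCat.{u} R)} (hS : S.ShortExact)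
    (h₂ : J ≤ Module.annihilator R S.X₂) : J ≤ Module.annihilator R S.X₁ :=
  h₂.trans (S.f.hom.annihilator_le_of_injective hS.moduleCat_injective_f)

/-- A finitely generated module killed by `J` is a quotient of a finite power of `R/J`. -/
theorem exists_surjective_pi_quotient {J : Ideal R} (W : ModuleCat.{u} R) [Module.Finite R W]
    (hW : J ≤ Module.annihilator R W) :
    ∃ (b : ℕ) (g : (Fin b → R ⧸ J) →ₗ[R] W), Function.Surjective g := by
  obtain ⟨b, f, hf⟩ := Module.Finite.exists_fin' R W
  have hJ : ∀ w : W, J ≤ LinearMap.ker (LinearMap.toSpanSingleton R W w) := fun w r hr => by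
    exact Module.mem_annihilator.1 (hW hr) w
  refine ⟨b, LinearMap.lsum R (fun _ => R ⧸ J) R
    (fun i => J.liftQ (LinearMap.toSpanSingleton R W (f (Pi.single i 1))) (hJ _)), fun w => ?_⟩
  obtain ⟨c, rfl⟩ := hf w
  refine ⟨fun i => J.mkQ (c i), ?_⟩
  conv_rhs => rw [← LinearMap.sum_single_apply (φ := fun _ : Fin b => R) c, map_sum]
  simp only [LinearMap.lsum_apply, LinearMap.sum_apply, LinearMap.comp_apply, LinearMap.proj_apply]
  refine Finset.sum_congr rfl fun i _ => ?_
  rw [Submodule.mkQ_apply, Submodule.liftQ_apply, LinearMap.toSpanSingleton_apply, ← map_smul,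
    ← Pi.single_smul, smul_eq_mul, mul_one]

/-- `Hom(R/J, K') ≃ K'` when `J` kills `K'`. -/
noncomputable def dualQuotientEquiv {J : Ideal R} (K' : ModuleCat.{u} R)
    (hK : J ≤ Module.annihilator R K') : ((R ⧸ J) →ₗ[R] K') ≃ₗ[R] K' :=
  LinearEquiv.ofBijective (LinearMap.applyₗ (J.mkQ 1)) <| by
    constructor
    · intro φ ψ h
      refine Submodule.linearMap_qext _ (LinearMap.ext_ring ?_)
      exact h
    · intro x
      refine ⟨J.liftQ (LinearMap.toSpanSingleton R K' x) fun r hr => ?_, ?_⟩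
      · exact Module.mem_annihilator.1 (hK hr) x
      · exact one_smul R x

theorem pi_quotient_annihilator (J : Ideal R) (b : ℕ) :
    J ≤ Module.annihilator R (Fin b → R ⧸ J) := by
  intro r hr
  rw [Module.mem_annihilator]
  intro c
  ext i
  have := Ideal.annihilator_quotient (I := J) ▸ hr
  exact Module.mem_annihilator.1 this (c i)

theorem IsRelDual.ext_pi_quotient {J : Ideal R} {n : ℕ} {K K' : ModuleCat.{u} R} {θ : Ext K' K n}
    (h : IsRelDual J n K K' θ) (b i : ℕ) (hi : n < i) :
    Subsingleton (Ext (ModuleCat.of R (Fin b → R ⧸ J)) K i) :=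
  ext_pi_left_subsingleton (ModuleCat.of R (R ⧸ J)) K b i (h.quotient i hi)

theorem IsRelDual.ext_dual_pi_quotient {J : Ideal R} {n : ℕ} {K K' : ModuleCat.{u} R}
    {θ : Ext K' K n} (h : IsRelDual J n K K' θ) (L : ModuleCat.{u} R) (b i : ℕ)
    (hi : Subsingleton (Ext L K' i)) :
    Subsingleton (Ext L (dual K' (ModuleCat.of R (Fin b → R ⧸ J))) i) := by
  let e : ((Fin b → R ⧸ J) →ₗ[R] K') ≃ₗ[R] (Fin b → K') :=
    (LinearMap.lsum R (fun _ : Fin b => R ⧸ J) R).symm.trans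
      (LinearEquiv.piCongrRight fun _ => dualQuotientEquiv K' h.le_annihilator)
  exact ext_subsingleton_of_iso_right (A := dual K' (ModuleCat.of R (Fin b → R ⧸ J)))
    (B := ModuleCat.of R (Fin b → K')) e.toModuleIso L i (ext_pi_right_subsingleton L K' b i hi)

variable [IsNoetherianRing R]

/-- A presentation `0 → W₁ → (R/J)^b → W → 0`. -/
theorem exists_cover {J : Ideal R} (W : ModuleCat.{u} R) [Module.Finite R W]
    (hW : J ≤ Module.annihilator R W) :
    ∃ (b : ℕ) (W₁ : ModuleCat.{u} R) (_ : Module.Finite R W₁)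
      (f : W₁ →ₗ[R] ModuleCat.of R (Fin b → R ⧸ J)) (g : ModuleCat.of R (Fin b → R ⧸ J) →ₗ[R] W)
      (h : Function.Exact f g), (sesOf f g h).ShortExact := by
  obtain ⟨b, g, hg⟩ := exists_surjective_pi_quotient W hW
  refine ⟨b, ModuleCat.of R (LinearMap.ker g), inferInstance, (LinearMap.ker g).subtype, g,
    LinearMap.exact_subtype_ker_map g, ?_⟩
  exact sesOf_shortExact (A := ModuleCat.of R (LinearMap.ker g))
    (B := ModuleCat.of R (Fin b → R ⧸ J)) _ g _ (Submodule.subtype_injective _) hg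

/-- Dualizing 0 → W₁ → (R/J)^b → W → 0 gives 0 → W* → K'^b → W₁* → 0, which is exact on the right
because Ext^{n+1}(W, K) = 0. This bounds Ext^{i+1}(L, W*) by Ext^i(L, W₁*), and W₁ inherits the
vanishing assumed for W. -/
theorem IsRelDual.ext_dual_subsingleton {J : Ideal R} {n : ℕ} {K K' : ModuleCat.{u} R}
    {θ : Ext K' K n} (h : IsRelDual J n K K' θ) (L : ModuleCat.{u} R) (s : ℕ)
    (hL : ∀ i < s, Subsingleton (Ext L K' i)) (i : ℕ) (hi : i < s) (W : ModuleCat.{u} R)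
    [Module.Finite R W] (hJ : J ≤ Module.annihilator R W)
    (hW : ∀ j, n < j → Subsingleton (Ext W K j)) : Subsingleton (Ext L (dual K' W) i) := by
  induction i generalizing W with
  | zero =>
    obtain ⟨b, W₁, _, f, g, hfg, hS⟩ := exists_cover W hJ
    have := h.ext_dual_pi_quotient L b 0 (hL 0 hi)
    have hinj := dualMap_injective K' g hS.moduleCat_surjective_g
    exact ext_zero_subsingleton_of_injective L _ hinj this
  | succ i ih =>
    obtain ⟨b, W₁, _, f, g, hfg, hS⟩ := exists_cover W hJ
    have hF := h.ext_dual_pi_quotient L b (i + 1) (hL _ hi)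
    have h₂ := pi_quotient_annihilator J b
    have h₁ := le_annihilator_X₁ hS h₂
    have hsurj := h.dualMap_surjective hS h₁ h₂ (hW _ (by omega))
    have hW₁ : ∀ j, n < j → Subsingleton (Ext W₁ K j) := fun j hj =>
      ext_left_subsingleton_X₁ hS K j (h.ext_pi_quotient b j hj) (hW _ (by omega))
    exact ext_succ_subsingleton_X₁ (sesOf_shortExact (dualMap K' g) (dualMap K' f)
      (dualMap_exact K' f g hfg hS.moduleCat_surjective_g)
      (dualMap_injective K' g hS.moduleCat_surjective_g) hsurj) L i
      (ih (by omega) W₁ h₁ hW₁) hF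

end ModuleLinkage

namespace ModuleLinkage

variable {R : Type u} [CommRing R]

/-! ### The evaluation map `Ext^g(L, Hom(A, K)) → Hom(A, Ext^g(L, K))` -/

/-- The map `Ext^g(L, Hom(A, K)) → Hom(A, Ext^g(L, K))` induced by the evaluations at the elements
of `A`. -/
noncomputable def extEval (L K A : ModuleCat.{u} R) (g : ℕ) :
    Ext L (dual K A) g →ₗ[R] (A →ₗ[R] Ext L K g) :=
  LinearMap.mk₂ R (fun ξ a => ξ.comp (Ext.mk₀ (ModuleCat.ofHom (LinearMap.applyₗ a :
      (A →ₗ[R] K) →ₗ[R] K))) (add_zero g))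
    (fun ξ ξ' a => by rw [Ext.add_comp]) (fun r ξ a => by rw [Ext.smul_comp])
    (fun ξ a a' => by rw [map_add, ModuleCat.ofHom_add, Ext.mk₀_add, Ext.comp_add])
    (fun r ξ a => by
      rw [map_smul]
      have : ModuleCat.ofHom (r • (LinearMap.applyₗ a : (A →ₗ[R] K) →ₗ[R] K)) =
        r • ModuleCat.ofHom (LinearMap.applyₗ a : (A →ₗ[R] K) →ₗ[R] K) := rfl
      rw [this, Ext.mk₀_smul, Ext.comp_smul])

theorem extEval_apply (L K A : ModuleCat.{u} R) (g : ℕ) (ξ : Ext L (dual K A) g) (a : A) :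
    extEval L K A g ξ a = ξ.comp (Ext.mk₀ (ModuleCat.ofHom (LinearMap.applyₗ a :
      (A →ₗ[R] K) →ₗ[R] K))) (add_zero g) := rfl

theorem extEval_naturality (L K : ModuleCat.{u} R) {A B : ModuleCat.{u} R} (g : ℕ) (f : A →ₗ[R] B)
    (ξ : Ext L (dual K B) g) :
    extEval L K A g (ξ.comp (Ext.mk₀ (ModuleCat.ofHom (dualMap K f))) (add_zero g)) =
      (extEval L K B g ξ).comp f := by
  ext a
  rw [extEval_apply, Ext.comp_assoc_of_third_deg_zero, Ext.mk₀_comp_mk₀]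
  rfl

theorem extEval_free_bijective (L K : ModuleCat.{u} R) (b g : ℕ) :
    Function.Bijective (extEval L K (ModuleCat.of R (Fin b → R)) g) := by
  let F := ModuleCat.of R (Fin b → R)
  let e : Fin b → F := fun i => Pi.single i (1 : R)
  let ι : Fin b → (K →ₗ[R] dual K F) := fun i =>
    LinearMap.mk₂ R (fun x (c : Fin b → R) => c i • x)
      (fun x y c => smul_add _ _ _) (fun r x c => smul_comm _ _ _)
      (fun x c c' => add_smul _ _ _) (fun r x c => mul_smul _ _ _)
  have hid : 𝟙 (dual K F) = ∑ i, ModuleCat.ofHom (LinearMap.applyₗ (e i) : (F →ₗ[R] K) →ₗ[R] K) ≫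
      ModuleCat.ofHom (ι i) := by
    refine ModuleCat.hom_ext (LinearMap.ext fun φ => LinearMap.pi_ext' fun j => ?_)
    refine LinearMap.ext_ring ?_
    simp [ModuleCat.hom_sum, ι, e, F, Pi.single_apply]
  have hι : ∀ i j, ModuleCat.ofHom (ι i) ≫
      ModuleCat.ofHom (LinearMap.applyₗ (e j) : (F →ₗ[R] K) →ₗ[R] K) =
      if i = j then 𝟙 K else 0 := by
    intro i j
    ext x
    by_cases h : i = j
    · simp [ι, e, h]
    · simp [ι, e, h]
  constructor
  · rw [injective_iff_map_eq_zero]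
    intro ξ hξ
    rw [← Ext.comp_mk₀_id ξ, hid, Ext.mk₀_sum, Ext.comp_sum]
    refine Finset.sum_eq_zero fun i _ => ?_
    rw [← Ext.mk₀_comp_mk₀, ← Ext.comp_assoc_of_third_deg_zero, ← extEval_apply, hξ,
      LinearMap.zero_apply, Ext.zero_comp]
  · intro h
    refine ⟨∑ i, (h (e i)).comp (Ext.mk₀ (ModuleCat.ofHom (ι i))) (add_zero g), ?_⟩
    refine LinearMap.pi_ext' fun j => LinearMap.ext_ring ?_
    change extEval L K F g _ (e j) = h (e j)
    rw [extEval_apply, Ext.sum_comp]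
    simp only [Ext.comp_assoc_of_third_deg_zero, Ext.mk₀_comp_mk₀, hι]
    rw [Finset.sum_eq_single j]
    · simp
    · intro i _ hij; simp [hij]
    · simp

/-- The degenerate case J = 0, n = 0 makes the facts about ordinary duality into K instances of
relative duality. -/
theorem isRelDual_zero (K : ModuleCat.{u} R) [Module.Finite R K] :
    IsRelDual ⊥ 0 K K (Ext.mk₀ (𝟙 K)) where
  finite := inferInstance
  le_annihilator := bot_le
  subsingleton := fun _ _ i hi => absurd hi (Nat.not_lt_zero i)
  bijective := fun W _ => by
    have : (fun f : W →ₗ[R] K => (Ext.mk₀ (ModuleCat.ofHom f)).comp (Ext.mk₀ (𝟙 K)) (zero_add 0)) =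
        Ext.addEquiv₀.symm ∘ (ModuleCat.homEquiv (M := W) (N := K)).symm := by
      funext f
      simp
      rfl
    rw [this]
    exact Ext.addEquiv₀.symm.bijective.comp ModuleCat.homEquiv.symm.bijective
  quotient := fun i hi => by
    obtain ⟨i, rfl⟩ := Nat.exists_eq_succ_of_ne_zero hi.ne'
    have e : ModuleCat.of R (R ⧸ (⊥ : Ideal R)) ≅ ModuleCat.of R R :=
      (Submodule.quotEquivOfEqBot (⊥ : Ideal R) rfl).toModuleIso
    have : Projective (ModuleCat.of R R) := ModuleCat.projective_of_free (ι := Unit)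
      (Module.Basis.singleton Unit R)
    exact ext_subsingleton_of_iso_left e K _ (Ext.subsingleton_of_projective _ K i)

variable [IsNoetherianRing R]

/-- A free presentation `0 → A₁ → R^b → A → 0`. -/
theorem exists_free_cover (A : ModuleCat.{u} R) [Module.Finite R A] :
    ∃ (b : ℕ) (A₁ : ModuleCat.{u} R) (_ : Module.Finite R A₁)
      (f : A₁ →ₗ[R] ModuleCat.of R (Fin b → R)) (g : ModuleCat.of R (Fin b → R) →ₗ[R] A)
      (h : Function.Exact f g), (sesOf f g h).ShortExact := by
  obtain ⟨b, g, hg⟩ := Module.Finite.exists_fin' R A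
  refine ⟨b, ModuleCat.of R (LinearMap.ker g), inferInstance, (LinearMap.ker g).subtype, g,
    LinearMap.exact_subtype_ker_map g, ?_⟩
  exact sesOf_shortExact (A := ModuleCat.of R (LinearMap.ker g))
    (B := ModuleCat.of R (Fin b → R)) _ g _ (Submodule.subtype_injective _) hg

omit [IsNoetherianRing R] in
theorem ext_free_subsingleton (K : ModuleCat.{u} R) (b i : ℕ) (hi : 0 < i) :
    Subsingleton (Ext (ModuleCat.of R (Fin b → R)) K i) := by
  obtain ⟨i, rfl⟩ := Nat.exists_eq_succ_of_ne_zero hi.ne'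
  have : Projective (ModuleCat.of R (Fin b → R)) := ModuleCat.projective_of_free (Pi.basisFun R _)
  exact Ext.subsingleton_of_projective _ K i

/-- If all higher `Ext^j(A, K)` vanish, then `Hom(A, K)` inherits the vanishing of `Ext^i(L, -)`
in low degrees from `K`. -/
theorem ext_dual_subsingleton (L K : ModuleCat.{u} R) [Module.Finite R K] (g : ℕ)
    (hL : ∀ i < g, Subsingleton (Ext L K i)) (A : ModuleCat.{u} R) [Module.Finite R A]
    (hA : ∀ j, 0 < j → Subsingleton (Ext A K j)) (i : ℕ) (hi : i < g) :
    Subsingleton (Ext L (dual K A) i) :=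
  (isRelDual_zero K).ext_dual_subsingleton L g hL i hi A bot_le hA

omit [IsNoetherianRing R] in
theorem dual_shortExact {K : ModuleCat.{u} R} [Module.Finite R K]
    {S : ShortComplex (ModuleCat.{u} R)} (hS : S.ShortExact) (h : Subsingleton (Ext S.X₃ K 1)) :
    (sesOf (dualMap K S.g.hom) (dualMap K S.f.hom) (dualMap_exact K S.f.hom S.g.hom
      (exact_of_shortExact hS) hS.moduleCat_surjective_g)).ShortExact :=
  sesOf_shortExact _ _ _ (dualMap_injective K S.g.hom hS.moduleCat_surjective_g)
    ((isRelDual_zero K).dualMap_surjective hS bot_le bot_le h)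

/-- For a free presentation 0 → A₁ → F → A → 0, the kernel of Ext^g(L, A*) → Ext^g(L, F*) comes from
Ext^{g-1}(L, A₁*) = 0. Naturality reduces the claim to F. -/
theorem extEval_injective (L K : ModuleCat.{u} R) [Module.Finite R K] (g : ℕ)
    (hL : ∀ i < g, Subsingleton (Ext L K i)) (A : ModuleCat.{u} R) [Module.Finite R A]
    (hA : ∀ j, 0 < j → Subsingleton (Ext A K j)) :
    Function.Injective (extEval L K A g) := by
  obtain ⟨b, A₁, _, f, p, hfp, hS⟩ := exists_free_cover A
  have hA₁ : ∀ j, 0 < j → Subsingleton (Ext A₁ K j) := fun j hj =>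
    ext_left_subsingleton_X₁ hS K j (ext_free_subsingleton K b j hj) (hA _ (by omega))
  have hD := dual_shortExact (K := K) hS (hA 1 one_pos)
  rw [injective_iff_map_eq_zero]
  intro ξ hξ
  refine ext_postcomp_injective hD L g (fun j hj =>
    ext_dual_subsingleton L K g hL A₁ hA₁ j (by omega)) ξ ?_
  refine (extEval_free_bijective L K b g).1 ?_
  refine ((extEval_naturality L K g p ξ).trans ?_).trans (map_zero _).symm
  rw [hξ, LinearMap.zero_comp]

/-- A four-lemma chase: the lift over the free cover dies in Ext^g(L, A₁*) by injectivity for the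
syzygy A₁, so it comes from Ext^g(L, A*). -/
theorem extEval_bijective (L K : ModuleCat.{u} R) [Module.Finite R K] (g : ℕ)
    (hL : ∀ i < g, Subsingleton (Ext L K i)) (A : ModuleCat.{u} R) [Module.Finite R A]
    (hA : ∀ j, 0 < j → Subsingleton (Ext A K j)) :
    Function.Bijective (extEval L K A g) := by
  refine ⟨extEval_injective L K g hL A hA, fun h => ?_⟩
  obtain ⟨b, A₁, _, f, p, hfp, hS⟩ := exists_free_cover A
  have hA₁ : ∀ j, 0 < j → Subsingleton (Ext A₁ K j) := fun j hj =>
    ext_left_subsingleton_X₁ hS K j (ext_free_subsingleton K b j hj) (hA _ (by omega))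
  have hD := dual_shortExact (K := K) hS (hA 1 one_pos)
  obtain ⟨ζ, hζ⟩ := (extEval_free_bijective L K b g).2 (h.comp p)
  obtain ⟨ξ, hξ⟩ := Ext.covariant_sequence_exact₂ L hD ζ (by
    refine extEval_injective L K g hL A₁ hA₁ ?_
    refine ((extEval_naturality L K g f ζ).trans ?_).trans (map_zero _).symm
    rw [hζ, LinearMap.comp_assoc, hfp.linearMap_comp_eq_zero, LinearMap.comp_zero])
  refine ⟨ξ, ?_⟩
  have := extEval_naturality L K g p ξ
  ext a
  obtain ⟨x, rfl⟩ := hS.moduleCat_surjective_g a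
  have h₂ : (extEval L K A g ξ).comp p = h.comp p := by
    rw [← hζ, ← hξ]; exact this.symm
  exact congr($h₂ x)

/-! ### Vanishing of `Ext` into a semidualizing module -/

omit [IsNoetherianRing R] in
theorem IsSemidualizing.annihilator_eq_bot {K : ModuleCat.{u} R} (hK : IsSemidualizing K) :
    Module.annihilator R K = ⊥ := by
  rw [eq_bot_iff]
  intro r hr
  refine (Submodule.mem_bot R).2 (hK.bijective_homothety.1 ?_)
  ext x
  exact (Module.mem_annihilator.1 hr x).trans (by simp)

/-- `Hom(K, K) ≃ R` for a semidualizing module `K`. -/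
noncomputable def IsSemidualizing.endIso {K : ModuleCat.{u} R} (hK : IsSemidualizing K) :
    ModuleCat.of R R ≅ dual K K :=
  (LinearEquiv.ofBijective (LinearMap.lsmul R K) hK.bijective_homothety).toModuleIso

theorem IsSemidualizing.ext_ring_subsingleton {K : ModuleCat.{u} R} (hK : IsSemidualizing K)
    (L : ModuleCat.{u} R) (s : ℕ) (hL : ∀ i < s, Subsingleton (Ext L K i)) (i : ℕ) (hi : i < s) :
    Subsingleton (Ext L (ModuleCat.of R R) i) := by
  have := hK.finite
  exact ext_subsingleton_of_iso_right hK.endIso L i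
    (ext_dual_subsingleton L K s hL K hK.ext_eq_zero i hi)

/-- In the first degree g not yet known to vanish, Hom(K, Ext^g(L, K)) ≅ Ext^g(L, Hom(K, K)) ≅
Ext^g(L, R) = 0. Since K is faithful, this forces Ext^g(L, K) = 0. -/
theorem IsSemidualizing.ext_subsingleton {K : ModuleCat.{u} R} (hK : IsSemidualizing K)
    (L : ModuleCat.{u} R) [Module.Finite R L] (s : ℕ)
    (hL : ∀ i < s, Subsingleton (Ext L (ModuleCat.of R R) i)) (i : ℕ) (hi : i < s) :
    Subsingleton (Ext L K i) := by
  have := hK.finite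
  induction i using Nat.strong_induction_on with
  | _ g ih =>
    have hg : ∀ i < g, Subsingleton (Ext L K i) := fun i hig => ih i hig (hig.trans hi)
    have hΦ := extEval_bijective L K g hg K hK.ext_eq_zero
    have h0 : Subsingleton (Ext L (dual K K) g) :=
      ext_subsingleton_of_iso_right hK.endIso.symm L g (hL g hi)
    have : Subsingleton (K →ₗ[R] Ext L K g) := hΦ.2.subsingleton
    -- Hom = 0 yields an element of the annihilator of K that is regular on Ext^g(L, K). That
    -- annihilator is zero, so 0 acts injectively.
    obtain ⟨r, hr, hreg⟩ := IsSMulRegular.subsingleton_linearMap_iff.1 this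
    rw [hK.annihilator_eq_bot, Submodule.mem_bot] at hr
    exact IsSMulRegular.zero_iff_subsingleton.1 (hr ▸ hreg)

end ModuleLinkage

namespace ModuleLinkage

variable {R : Type u} [CommRing R]

/-! ### Depth -/

section Local

variable [IsLocalRing R]

variable (R) in
/-- The residue field as a module. -/
noncomputable abbrev residue : ModuleCat.{u} R := ModuleCat.of R (IsLocalRing.ResidueField R)

theorem residue_annihilator :
    Module.annihilator R (residue R) = IsLocalRing.maximalIdeal R :=
  Ideal.annihilator_quotient

/-- Lists of zeros of any length are weakly regular on the zero module. -/
theorem depth_of_subsingleton (M : ModuleCat.{u} R) [Subsingleton M] : depth M = ⊤ := by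
  refine ENat.eq_top_iff_forall_ge.2 fun s => ?_
  have h : (∀ r ∈ List.replicate s (0 : R), r ∈ IsLocalRing.maximalIdeal R) ∧
      RingTheory.Sequence.IsWeaklyRegular M (List.replicate s (0 : R)) := by
    refine ⟨fun r hr => ?_, ⟨fun i hi => ?_⟩⟩
    · rw [List.eq_of_mem_replicate hr]; exact zero_mem _
    · exact fun a b _ => Subsingleton.elim _ _
  have := le_iSup₂ (f := fun (rs : List R) (_ : (∀ r ∈ rs, r ∈ IsLocalRing.maximalIdeal R) ∧
    RingTheory.Sequence.IsWeaklyRegular M rs) => (rs.length : ℕ∞)) _ h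
  rwa [List.length_replicate] at this

variable [IsNoetherianRing R]

omit [IsNoetherianRing R] in
theorem maximalIdeal_smul_top_lt (M : ModuleCat.{u} R) [Module.Finite R M] [Nontrivial M] :
    IsLocalRing.maximalIdeal R • (⊤ : Submodule R M) < ⊤ := by
  refine lt_top_iff_ne_top.2 fun h => ?_
  have := Submodule.eq_bot_of_eq_ideal_smul_of_le_jacobson_annihilator
    (N := (⊤ : Submodule R M)) Module.Finite.fg_top h.symm ((IsLocalRing.maximalIdeal_le_jacobson _))
  exact bot_ne_top this.symm

/-- Rees' characterization of depth. The zero module fits because its depth is `⊤`. -/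
theorem le_depth_iff (M : ModuleCat.{u} R) [Module.Finite R M] (s : ℕ) :
    (s : ℕ∞) ≤ depth M ↔ ∀ i < s, Subsingleton (Ext (residue R) M i) := by
  have hk : Module.support R (residue R) =
      PrimeSpectrum.zeroLocus (IsLocalRing.maximalIdeal R) := by
    rw [Module.support_eq_zeroLocus, residue_annihilator]
  cases subsingleton_or_nontrivial M with
  | inl h =>
    rw [depth_of_subsingleton M]
    exact ⟨fun _ i _ => ext_subsingleton_of_subsingleton_right _ M i, fun _ => le_top⟩
  | inr h =>
    have hlt := maximalIdeal_smul_top_lt M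
    constructor
    · intro hs
      have : ∃ rs : List R, ((∀ r ∈ rs, r ∈ IsLocalRing.maximalIdeal R) ∧
          RingTheory.Sequence.IsWeaklyRegular M rs) ∧ s ≤ rs.length := by
        by_contra! hcon
        cases s with
        | zero => exact absurd (hcon [] ⟨by simp, .nil R M⟩) (by simp)
        | succ s =>
          have : depth M ≤ s := iSup₂_le fun rs hrs => by
            exact_mod_cast Nat.lt_succ_iff.1 (hcon rs hrs)
          have := hs.trans this
          norm_cast at this
          omega
      obtain ⟨rs, ⟨hm, hreg⟩, hlen⟩ := this
      intro i hi
      exact ModuleCat.subsingleton_ext_of_exists_isRegular (IsLocalRing.maximalIdeal R) (residue R)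
        hk.subset M hlt rs hm
        ((IsLocalRing.isRegular_iff_isWeaklyRegular_of_subset_maximalIdeal hm).2 hreg) i
        (hi.trans_le hlen)
    · intro hs
      obtain ⟨rs, hlen, hm, hreg⟩ := ModuleCat.exists_isRegular_of_exists_subsingleton_ext
        (IsLocalRing.maximalIdeal R) s M hlt (residue R) hk hs
      rw [← hlen]
      exact le_iSup₂ (f := fun (rs : List R) (_ : (∀ r ∈ rs, r ∈ IsLocalRing.maximalIdeal R) ∧
        RingTheory.Sequence.IsWeaklyRegular M rs) => (rs.length : ℕ∞)) rs
        ⟨hm, hreg.toIsWeaklyRegular⟩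

theorem depth_eq_iff (M : ModuleCat.{u} R) [Module.Finite R M] (s : ℕ) :
    depth M = s ↔ (∀ i < s, Subsingleton (Ext (residue R) M i)) ∧
      ¬ Subsingleton (Ext (residue R) M s) := by
  rw [← le_depth_iff]
  constructor
  · intro h
    refine ⟨h.ge, fun hsub => ?_⟩
    have : ((s + 1 : ℕ) : ℕ∞) ≤ depth M := (le_depth_iff M _).2 fun i hi => by
      rcases Nat.lt_succ_iff_lt_or_eq.1 hi with h' | rfl
      · exact (le_depth_iff M s).1 h.ge i h'
      · exact hsub
    rw [h] at this
    norm_cast at this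
    omega
  · rintro ⟨h₁, h₂⟩
    refine le_antisymm (not_lt.1 fun hlt => h₂ ?_) h₁
    have : ((s + 1 : ℕ) : ℕ∞) ≤ depth M := by
      push_cast; exact Order.add_one_le_of_lt hlt
    exact (le_depth_iff M _).1 this s (Nat.lt_succ_self s)

theorem depth_eq_of_iso {A B : ModuleCat.{u} R} [Module.Finite R A] [Module.Finite R B]
    (e : A ≅ B) : depth A = depth B := by
  refine ENat.eq_of_forall_natCast_le_iff fun s => ?_
  rw [le_depth_iff, le_depth_iff]
  exact ⟨fun h i hi => ext_subsingleton_of_iso_right e.symm _ i (h i hi),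
    fun h i hi => ext_subsingleton_of_iso_right e _ i (h i hi)⟩

theorem depth_le_supportDim (M : ModuleCat.{u} R) [Module.Finite R M] [Nontrivial M] :
    ((depth M : ℕ∞) : WithBot ℕ∞) ≤ Module.supportDim R M := by
  have hne := Module.supportDim_ne_bot_of_nontrivial R M
  obtain ⟨D, hD⟩ := WithBot.ne_bot_iff_exists.1 hne
  rw [← hD, WithBot.coe_le_coe]
  refine iSup₂_le fun rs hrs => ?_
  have hreg := (IsLocalRing.isRegular_iff_isWeaklyRegular_of_subset_maximalIdeal hrs.1).2 hrs.2
  have h := Module.supportDim_add_length_eq_supportDim_of_isRegular rs hreg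
  have hnt := hreg.quot_ofList_smul_nontrivial
  obtain ⟨D', hD'⟩ := WithBot.ne_bot_iff_exists.1 (Module.supportDim_ne_bot_of_nontrivial R
    (M ⧸ Ideal.ofList rs • (⊤ : Submodule R M)))
  rw [← hD', ← hD] at h
  have h' : D' + (rs.length : ℕ∞) = D := by exact_mod_cast h
  rw [← h']
  exact le_add_self

/-- If the middle term of a short exact sequence has depth at least `b`, then the depth of the
kernel exceeds the depth of the cokernel by one, as long as this does not exceed `b`. -/
theorem depth_X₁_eq {S : ShortComplex (ModuleCat.{u} R)} (hS : S.ShortExact)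
    [Module.Finite R S.X₁] [Module.Finite R S.X₃] (b : ℕ)
    (hb : ∀ i < b, Subsingleton (Ext (residue R) S.X₂ i)) (hd : depth S.X₃ + 1 ≤ b) :
    depth S.X₁ = depth S.X₃ + 1 := by
  have hne : depth S.X₃ ≠ ⊤ := fun h => by simp [h] at hd
  obtain ⟨c, hc⟩ := ENat.ne_top_iff_exists.1 hne
  rw [← hc] at hd ⊢
  have hcb : c + 1 ≤ b := by exact_mod_cast hd
  obtain ⟨h₁, h₂⟩ := (depth_eq_iff S.X₃ c).1 hc.symm
  refine (depth_eq_iff S.X₁ (c + 1)).2 ⟨fun i hi => ?_, fun h => h₂ ?_⟩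
  · cases i with
    | zero =>
      exact ext_zero_subsingleton_of_injective _ S.f.hom hS.moduleCat_injective_f
        (hb 0 (by omega))
    | succ i => exact ext_succ_subsingleton_X₁ hS _ i (h₁ i (by omega)) (hb _ (by omega))
  · exact ext_subsingleton_X₃ hS _ c (hb c (by omega)) h

/-! ### Dimension and grade -/

/-- The annihilator of L contains an R-regular sequence of length t, so L lives over a quotient of R
of dimension dim R - t. -/
theorem supportDim_add_le (L : ModuleCat.{u} R) [Module.Finite R L] (t : ℕ)
    (h : ∀ i < t, Subsingleton (Ext L (ModuleCat.of R R) i)) :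
    Module.supportDim R L + t ≤ ringKrullDim R := by
  cases subsingleton_or_nontrivial L with
  | inl _ => rw [Module.supportDim_eq_bot_of_subsingleton, WithBot.bot_add]; exact bot_le
  | inr _ =>
    have hann : Module.annihilator R L ≤ IsLocalRing.maximalIdeal R :=
      IsLocalRing.le_maximalIdeal fun h => by
        rw [Module.annihilator_eq_top_iff] at h
        exact not_subsingleton L h
    obtain ⟨rs, hlen, hmem, hreg⟩ := ModuleCat.exists_isRegular_of_exists_subsingleton_ext
      (Module.annihilator R L) t (ModuleCat.of R R) (by
        refine lt_of_le_of_lt ?_ (maximalIdeal_smul_top_lt (ModuleCat.of R R))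
        exact Submodule.smul_mono_left hann) L (Module.support_eq_zeroLocus) h
    have hreg' : RingTheory.Sequence.IsRegular R rs := hreg
    rw [← ringKrullDim_add_length_eq_ringKrullDim_of_isRegular rs hreg', hlen]
    gcongr
    rw [Module.supportDim_eq_ringKrullDim_quotient_annihilator]
    have hle : Ideal.ofList rs ≤ Module.annihilator R L := Ideal.span_le.2 hmem
    exact ringKrullDim_le_of_surjective (Ideal.Quotient.factor hle)
      (Ideal.Quotient.factor_surjective hle)

/-- **Ischebeck's theorem**: `Ext^i(L, N) = 0` for `i < depth N - dim L`. -/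
theorem ext_subsingleton_of_add_supportDim_lt (N : ModuleCat.{u} R) [Module.Finite R N] (s : ℕ)
    (hN : ∀ i < s, Subsingleton (Ext (residue R) N i)) (r : ℕ) (L : Type u) [AddCommGroup L]
    [Module R L] [hL : Module.Finite R L] (hdim : Module.supportDim R L ≤ r) (i : ℕ)
    (hi : i + r < s) : Subsingleton (Ext (ModuleCat.of R L) N i) := by
  induction r using Nat.strong_induction_on generalizing L i with
  | _ r ihr =>
  induction hL using IsNoetherianRing.induction_on_isQuotientEquivQuotientPrime R generalizing i with
  | subsingleton L =>
    have : Subsingleton (ModuleCat.of R L) := ‹Subsingleton L›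
    exact ext_subsingleton_of_subsingleton_left _ N i
  | exact L₁ L₂ L₃ f g hf hg hfg h₁ h₃ =>
    exact ext_left_subsingleton_X₂ (sesOf_shortExact (A := ModuleCat.of R L₁)
      (B := ModuleCat.of R L₂) (C := ModuleCat.of R L₃) f g hfg hf hg) N i
      (h₁ ((Module.supportDim_le_of_injective f hf).trans hdim) i hi)
      (h₃ ((Module.supportDim_le_of_surjective g hg).trans hdim) i hi)
  | quotient L p e =>
    by_cases hp : p.1 = IsLocalRing.maximalIdeal R
    · rw [hp] at e
      exact ext_subsingleton_of_iso_left (A := ModuleCat.of R L) (B := residue R) e.toModuleIso N i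
        (hN i (by omega))
    -- An x in the maximal ideal outside p is regular on R/p, and the quotient has smaller
    -- dimension. The inductive vanishing of Ext^{i+1}(L/xL, N) makes x act surjectively on Ext^i(L,
    -- N), which Nakayama's lemma then kills.
    · obtain ⟨x, hxm, hxp⟩ := SetLike.not_le_iff_exists.1 fun hle : IsLocalRing.maximalIdeal R ≤ p.1 =>
        hp ((IsLocalRing.maximalIdeal.isMaximal R).eq_of_le p.2.ne_top hle).symm
      have hreg : IsSMulRegular L x := by
        rw [e.isSMulRegular_congr]
        refine isSMulRegular_quotient_iff_mem_of_smul_mem _ _ |>.2 fun y hy => ?_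
        exact (p.2.mem_or_mem hy).resolve_left hxp
      have : Nontrivial L := e.toEquiv.nontrivial_congr.2 (Ideal.Quotient.nontrivial_iff.2 p.2.ne_top)
      have : Nontrivial (QuotSMulTop x L) := nontrivial_quotSMulTop_of_mem_maximalIdeal L hxm
      have hq := Module.supportDim_quotSMulTop_succ_eq_supportDim hreg hxm
      obtain ⟨q, hq'⟩ := WithBot.ne_bot_iff_exists.1
        (Module.supportDim_ne_bot_of_nontrivial R (QuotSMulTop x L))
      rw [← hq', eq_comm] at hq
      rw [hq] at hdim
      have hdim' : q + 1 ≤ r := by exact_mod_cast hdim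
      cases r with
      | zero => simp at hdim'
      | succ r =>
        have hqr : q ≤ r := by
          push_cast at hdim'
          exact (ENat.add_le_add_iff_right ENat.one_ne_top).1 hdim'
        have hvan : Subsingleton (Ext (ModuleCat.of R (QuotSMulTop x L)) N (i + 1)) :=
          ihr r (Nat.lt_succ_self r) (QuotSMulTop x L) (by
            rw [← hq']; exact_mod_cast hqr) (i + 1) (by omega)
        have hS : (ModuleCat.smulShortComplex (ModuleCat.of R L) x).ShortExact :=
          IsSMulRegular.smulShortComplex_shortExact (M := ModuleCat.of R L) hreg
        have hsmul : ∀ y : Ext (ModuleCat.of R L) N i, ∃ z, x • z = y := by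
          intro y
          obtain ⟨z, hz⟩ := Ext.contravariant_sequence_exact₁ hS N y (add_comm 1 i)
            (hvan.elim _ _)
          refine ⟨z, ?_⟩
          exact (mk₀_smul_id_comp (A := ModuleCat.of R L) x i z).symm.trans hz
        have hfin : Module.Finite R (Ext (ModuleCat.of R L) N i) := inferInstance
        refine (Submodule.subsingleton_iff R).1 (subsingleton_iff_bot_eq_top.1 ?_)
        refine (Submodule.eq_bot_of_eq_ideal_smul_of_le_jacobson_annihilator
          (I := IsLocalRing.maximalIdeal R)
          (N := (⊤ : Submodule R (Ext (ModuleCat.of R L) N i))) Module.Finite.fg_top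
          (le_antisymm ?_ le_top) (IsLocalRing.maximalIdeal_le_jacobson _)).symm
        intro y _
        obtain ⟨z, rfl⟩ := hsmul y
        exact Submodule.smul_mem_smul hxm Submodule.mem_top

end Local

end ModuleLinkage

namespace ModuleLinkage

variable {R : Type u} [CommRing R]

/-! ### Modules of finite `G_K`-dimension -/

theorem bijective_eval_iff {A K : Type u} [AddCommGroup A] [Module R A] [AddCommGroup K]
    [Module R K] :
    Function.Bijective ((LinearMap.id : (A →ₗ[R] K) →ₗ[R] (A →ₗ[R] K)).flip) ↔
      (∀ a : A, (∀ φ : A →ₗ[R] K, φ a = 0) → a = 0) ∧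
        ∀ Ψ : (A →ₗ[R] K) →ₗ[R] K, ∃ a : A, ∀ φ : A →ₗ[R] K, Ψ φ = φ a := by
  refine and_congr ?_ ?_
  · rw [injective_iff_map_eq_zero]
    refine forall_congr' fun a => imp_congr_left ?_
    rw [LinearMap.ext_iff]
    rfl
  · refine forall_congr' fun Ψ => exists_congr fun a => ?_
    rw [LinearMap.ext_iff]
    exact forall_congr' fun φ => eq_comm

theorem IsTotallyReflexive.of_equiv {K A B : ModuleCat.{u} R} (h : IsTotallyReflexive K A)
    (e : A ≃ₗ[R] B) : IsTotallyReflexive K B where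
  finite := have := h.finite; Module.Finite.equiv e
  bijective_eval := by
    obtain ⟨h₁, h₂⟩ := bijective_eval_iff.1 h.bijective_eval
    refine bijective_eval_iff.2 ⟨fun b hb => ?_, fun Ψ => ?_⟩
    · refine e.symm.injective ((h₁ _ fun φ => ?_).trans (map_zero e.symm).symm)
      exact hb (φ ∘ₗ e.symm.toLinearMap)
    · obtain ⟨a, ha⟩ := h₂ (Ψ ∘ₗ LinearMap.lcomp R K e.symm.toLinearMap)
      refine ⟨e a, fun φ => ?_⟩
      refine Eq.trans ?_ (ha (φ ∘ₗ e.toLinearMap))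
      rw [LinearMap.comp_apply]
      congr 1
      ext x
      simp
  ext_eq_zero := fun i hi =>
    ext_subsingleton_of_iso_left e.symm.toModuleIso K i (h.ext_eq_zero i hi)
  ext_dual_eq_zero := fun i hi =>
    ext_subsingleton_of_iso_left (A := dual K B) (B := dual K A)
      (LinearEquiv.congrLeft K R e.symm).toModuleIso K i (h.ext_dual_eq_zero i hi)

/-- `GKLe K t M` says that the `G_K`-dimension of `M` is at most `t`. -/
def GKLe (K : ModuleCat.{u} R) : ℕ → ModuleCat.{u} R → Prop
  | 0, M => IsTotallyReflexive K M
  | t + 1, M => ∃ (C G : ModuleCat.{u} R) (f : C →ₗ[R] G) (g : G →ₗ[R] M) (h : Function.Exact f g),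
      (sesOf f g h).ShortExact ∧ IsTotallyReflexive K G ∧ GKLe K t C

theorem GKResolution.gkLe {K : ModuleCat.{u} R} (n : ℕ) {M : ModuleCat.{u} R}
    (P : GKResolution K M) (hP : P.LengthLE n) : GKLe K n M := by
  induction n generalizing M with
  | zero =>
    have := hP 1 one_pos
    have hinj : Function.Injective P.aug := by
      rw [injective_iff_map_eq_zero]
      intro x hx
      obtain ⟨y, rfl⟩ := (P.exact_aug x).1 hx
      rw [Subsingleton.elim y 0, map_zero]
    exact (P.isTotallyReflexive 0).of_equiv (LinearEquiv.ofBijective P.aug ⟨hinj, P.surjective_aug⟩)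
  | succ n ih =>
    let C := ModuleCat.of R (LinearMap.ker P.aug)
    let Q : GKResolution K C :=
      { G := fun i => P.G (i + 1)
        d := fun i => P.d (i + 1)
        aug := (P.d 0).codRestrict (LinearMap.ker P.aug) fun x => P.exact_aug.apply_apply_eq_zero x
        isTotallyReflexive := fun i => P.isTotallyReflexive (i + 1)
        surjective_aug := by
          rintro ⟨x, hx⟩
          obtain ⟨y, rfl⟩ := (P.exact_aug x).1 hx
          exact ⟨y, rfl⟩
        exact_aug := fun x => by
          rw [← P.exact_d 0 x]
          exact Subtype.ext_iff
        exact_d := fun i => P.exact_d (i + 1) }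
    refine ⟨C, P.G 0, (LinearMap.ker P.aug).subtype, P.aug, LinearMap.exact_subtype_ker_map _,
      sesOf_shortExact (A := C) _ _ _ (Submodule.subtype_injective _) P.surjective_aug,
      P.isTotallyReflexive 0, ih Q fun i hi => hP (i + 1) (by omega)⟩

theorem isTotallyReflexive_of_subsingleton (K M : ModuleCat.{u} R) [Subsingleton M] :
    IsTotallyReflexive K M where
  finite := inferInstance
  bijective_eval := bijective_eval_iff.2 ⟨fun _ _ => Subsingleton.elim _ _, fun Ψ => ⟨0, fun φ => by
    rw [Subsingleton.elim φ 0, map_zero, map_zero]⟩⟩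
  ext_eq_zero := fun i _ => ext_subsingleton_of_subsingleton_left M K i
  ext_dual_eq_zero := fun i _ =>
    have : Subsingleton (ModuleCat.of R (M →ₗ[R] K)) :=
      inferInstanceAs (Subsingleton (M →ₗ[R] K))
    ext_subsingleton_of_subsingleton_left _ K i

theorem GKLe.exists_resolution {K : ModuleCat.{u} R} {n : ℕ} {M : ModuleCat.{u} R}
    (h : GKLe K n M) : ∃ P : GKResolution K M, P.LengthLE n := by
  induction n generalizing M with
  | zero =>
    have hP : Subsingleton (ModuleCat.of R PUnit.{u + 1}) := inferInstanceAs (Subsingleton PUnit)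
    refine ⟨{ G := fun i => match i with | 0 => M | _ + 1 => ModuleCat.of R PUnit
              d := fun i => 0
              aug := LinearMap.id
              isTotallyReflexive := fun i => match i with
                | 0 => h
                | _ + 1 => isTotallyReflexive_of_subsingleton K _
              surjective_aug := Function.surjective_id
              exact_aug := fun x => by simp [eq_comm]
              exact_d := fun i x => ⟨fun _ => ⟨0, hP.elim _ _⟩, fun _ => rfl⟩ }, fun i hi => ?_⟩
    obtain ⟨i, rfl⟩ := Nat.exists_eq_succ_of_ne_zero hi.ne'
    exact hP
  | succ n ih =>
    obtain ⟨C, G, f, g, hfg, hS, hG, hC⟩ := h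
    obtain ⟨Q, hQ⟩ := ih hC
    refine ⟨{ G := fun i => match i with | 0 => G | i + 1 => Q.G i
              d := fun i => match i with | 0 => f ∘ₗ Q.aug | i + 1 => Q.d i
              aug := g
              isTotallyReflexive := fun i => match i with
                | 0 => hG
                | i + 1 => Q.isTotallyReflexive i
              surjective_aug := hS.moduleCat_surjective_g
              exact_aug := fun x => ?_
              exact_d := fun i => match i with
                | 0 => fun x => ?_
                | i + 1 => Q.exact_d i }, fun i hi => ?_⟩
    · rw [hfg x]
      constructor
      · rintro ⟨y, rfl⟩
        obtain ⟨z, rfl⟩ := Q.surjective_aug y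
        exact ⟨z, rfl⟩
      · rintro ⟨z, rfl⟩
        exact ⟨Q.aug z, rfl⟩
    · rw [← Q.exact_aug x]
      constructor
      · intro hx
        exact hS.moduleCat_injective_f ((show f (Q.aug x) = 0 from hx).trans (map_zero f).symm)
      · intro hx
        change f (Q.aug x) = 0
        rw [hx, map_zero]
    · obtain ⟨i, rfl⟩ := Nat.exists_eq_succ_of_ne_zero (Nat.ne_zero_of_lt hi)
      exact hQ i (by omega)

theorem gkDim_le_of_gkLe {K : ModuleCat.{u} R} {n : ℕ} {M : ModuleCat.{u} R}
    (h : GKLe K n M) : gkDim K M ≤ n :=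
  iInf₂_le (f := fun (n : ℕ) (_ : ∃ P : GKResolution K M, P.LengthLE n) => (n : ℕ∞)) n
    h.exists_resolution

theorem gkLe_of_gkDim_eq {K : ModuleCat.{u} R} {t : ℕ} {M : ModuleCat.{u} R}
    (h : gkDim K M = t) : GKLe K t M := by
  by_contra hcon
  have : ((t + 1 : ℕ) : ℕ∞) ≤ gkDim K M := by
    refine le_iInf₂ fun n hn => ?_
    obtain ⟨P, hP⟩ := hn
    have h₁ : gkDim K M ≤ n := gkDim_le_of_gkLe (P.gkLe n hP)
    rw [h] at h₁
    have h₂ : t ≤ n := by exact_mod_cast h₁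
    have h₃ : n ≠ t := by rintro rfl; exact hcon (P.gkLe n hP)
    exact_mod_cast (by omega : t + 1 ≤ n)
  rw [h] at this
  norm_cast at this
  omega

theorem GKLe.ext_subsingleton {K : ModuleCat.{u} R} {t : ℕ} {M : ModuleCat.{u} R}
    (h : GKLe K t M) (i : ℕ) (hi : t < i) : Subsingleton (Ext M K i) := by
  induction t generalizing M i with
  | zero => exact h.ext_eq_zero i hi
  | succ t ih =>
    obtain ⟨C, G, f, g, hfg, hS, hG, hC⟩ := h
    obtain ⟨i, rfl⟩ := Nat.exists_eq_succ_of_ne_zero (Nat.ne_zero_of_lt hi)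
    exact ext_succ_left_subsingleton_X₃ hS K i (ih hC i (by omega))
      (hG.ext_eq_zero _ (by omega))

/-- The isomorphism of a totally reflexive module with its bidual. -/
noncomputable def IsTotallyReflexive.evalIso {K G : ModuleCat.{u} R} (h : IsTotallyReflexive K G) :
    G ≅ dual K (dual K G) :=
  (LinearEquiv.ofBijective _ h.bijective_eval).toModuleIso

/-- Ext^1(M, K) = 0 makes 0 → M* → G* → C* → 0 exact, and Ext^1(C*, K) = 0 makes its dual exact as
well. Reflexivity of M then follows by comparing the original sequence with its bidual. -/
theorem isTotallyReflexive_of_ext_one_subsingleton {K C G M : ModuleCat.{u} R}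
    [Module.Finite R K] {f : C →ₗ[R] G} {g : G →ₗ[R] M} {h : Function.Exact f g}
    (hS : (sesOf f g h).ShortExact) (hC : IsTotallyReflexive K C) (hG : IsTotallyReflexive K G)
    (hM : Subsingleton (Ext M K 1)) : IsTotallyReflexive K M := by
  have hD := dual_shortExact (K := K) hS hM
  obtain ⟨c₁, c₂⟩ := bijective_eval_iff.1 hC.bijective_eval
  obtain ⟨g₁, g₂⟩ := bijective_eval_iff.1 hG.bijective_eval
  refine ⟨?_, ?_, ?_, ?_⟩
  · have := hG.finite
    exact Module.Finite.of_surjective g hS.moduleCat_surjective_g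
  · refine bijective_eval_iff.2 ⟨fun m hm => ?_, fun Ψ => ?_⟩
    · obtain ⟨x, rfl⟩ : ∃ x : G, g x = m := hS.moduleCat_surjective_g m
      have hker : LinearMap.ker (dualMap K f) ≤
          LinearMap.ker (LinearMap.applyₗ x : (G →ₗ[R] K) →ₗ[R] K) := by
        intro φ hφ
        obtain ⟨ψ, rfl⟩ := (exact_of_shortExact hD φ).1 hφ
        exact hm ψ
      obtain ⟨y, hy⟩ := c₂ (((LinearMap.ker (dualMap K f)).liftQ
        (LinearMap.applyₗ x : (G →ₗ[R] K) →ₗ[R] K) hker).comp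
        ((dualMap K f).quotKerEquivOfSurjective hD.moduleCat_surjective_g).symm.toLinearMap)
      have hxy : x - f y = 0 := g₁ _ fun φ => by
        have h1 := hy (φ ∘ₗ f)
        have h2 : ((dualMap K f).quotKerEquivOfSurjective hD.moduleCat_surjective_g).symm
            (φ ∘ₗ f) = (LinearMap.ker (dualMap K f)).mkQ φ := by
          rw [LinearEquiv.symm_apply_eq]; rfl
        rw [LinearMap.comp_apply, LinearEquiv.coe_coe, h2] at h1
        rw [map_sub, sub_eq_zero]
        exact h1
      rw [sub_eq_zero.1 hxy]
      exact h.apply_apply_eq_zero y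
    · have hsurj := (isRelDual_zero K).dualMap_surjective hD bot_le bot_le
        (hC.ext_dual_eq_zero 1 one_pos)
      obtain ⟨Ψ', hΨ'⟩ := hsurj Ψ
      obtain ⟨x, hx⟩ := g₂ Ψ'
      refine ⟨g x, fun φ => ?_⟩
      rw [← hΨ']
      exact hx (φ ∘ₗ g)
  · intro i hi
    rcases Nat.lt_or_ge 1 i with h1 | h1
    · obtain ⟨i, rfl⟩ := Nat.exists_eq_succ_of_ne_zero hi.ne'
      exact ext_succ_left_subsingleton_X₃ hS K i (hC.ext_eq_zero i (by omega))
        (hG.ext_eq_zero _ hi)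
    · obtain rfl : i = 1 := by omega
      exact hM
  · intro i hi
    exact ext_left_subsingleton_X₁ hD K i (hG.ext_dual_eq_zero i hi)
      (hC.ext_dual_eq_zero _ (by omega))

/-- Dimension shifting moves the vanishing down to the last step of the resolution, where it becomes
an Ext^1. Consequently a positive finite G_K-dimension is detected by the top Ext into K. -/
theorem GKLe.of_ext_subsingleton {K : ModuleCat.{u} R} [Module.Finite R K] {t : ℕ}
    {M : ModuleCat.{u} R} (h : GKLe K (t + 1) M) (hM : Subsingleton (Ext M K (t + 1))) :
    GKLe K t M := by
  induction t generalizing M with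
  | zero =>
    obtain ⟨C, G, f, g, hfg, hS, hG, hC⟩ := h
    exact isTotallyReflexive_of_ext_one_subsingleton hS hC hG hM
  | succ t ih =>
    obtain ⟨C, G, f, g, hfg, hS, hG, hC⟩ := h
    exact ⟨C, G, f, g, hfg, hS, hG, ih hC
      (ext_left_subsingleton_X₁ hS K (t + 1) (hG.ext_eq_zero _ (Nat.succ_pos _)) hM)⟩

theorem not_subsingleton_ext_of_gkDim_eq {K : ModuleCat.{u} R} [Module.Finite R K] {t : ℕ}
    {M : ModuleCat.{u} R} (h : gkDim K M = (t + 1 : ℕ)) : ¬ Subsingleton (Ext M K (t + 1)) := by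
  intro hM
  have := gkDim_le_of_gkLe ((gkLe_of_gkDim_eq h).of_ext_subsingleton hM)
  rw [h] at this
  norm_cast at this
  omega

variable [IsNoetherianRing R]

theorem IsTotallyReflexive.ext_subsingleton {K G : ModuleCat.{u} R} [Module.Finite R K]
    (hG : IsTotallyReflexive K G) (L : ModuleCat.{u} R) (s : ℕ)
    (hL : ∀ i < s, Subsingleton (Ext L K i)) (i : ℕ) (hi : i < s) :
    Subsingleton (Ext L G i) := by
  have := hG.finite
  exact ext_subsingleton_of_iso_right hG.evalIso L i
    (ext_dual_subsingleton L K s hL (dual K G) hG.ext_dual_eq_zero i hi)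

theorem GKLe.ext_right_subsingleton {K : ModuleCat.{u} R} [Module.Finite R K] {t : ℕ}
    {M : ModuleCat.{u} R} (h : GKLe K t M) (L : ModuleCat.{u} R) (s : ℕ)
    (hL : ∀ i < s, Subsingleton (Ext L K i)) (i : ℕ) (hi : i + t < s) :
    Subsingleton (Ext L M i) := by
  induction t generalizing M i with
  | zero => exact IsTotallyReflexive.ext_subsingleton h L s hL i hi
  | succ t ih =>
    obtain ⟨C, G, f, g, hfg, hS, hG, hC⟩ := h
    exact ext_subsingleton_X₃ hS L i (hG.ext_subsingleton L s hL i (by omega))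
      (ih hC (i + 1) (by omega))

/-- After shifting to 0 → C → G → M → 0 with C and G totally reflexive, Ext^1(M, K) is the cokernel
of G* → C*. A map u out of it is a map C* → Ext^s(L, K) vanishing on G*, that is, an element of
Ext^s(L, C) dying in Ext^s(L, G). Such an element comes from Ext^{s-1}(L, M), which is zero. -/
theorem GKLe.linearMap_ext_eq_zero {K : ModuleCat.{u} R} [Module.Finite R K] (L : ModuleCat.{u} R)
    (s : ℕ) (hL : ∀ i < s, Subsingleton (Ext L K i)) (t : ℕ) {M : ModuleCat.{u} R}
    (h : GKLe K (t + 1) M) (hLM : ∀ i, i + (t + 1) ≤ s → Subsingleton (Ext L M i))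
    (u : Ext M K (t + 1) →ₗ[R] Ext L K s) : u = 0 := by
  induction t generalizing M with
  | zero =>
    obtain ⟨C, G, f, g, hfg, hS, hG, hC⟩ := h
    have hC : IsTotallyReflexive K C := hC
    have := hC.finite
    have := hG.finite
    let δ : (C →ₗ[R] K) →ₗ[R] Ext M K 1 :=
      (hS.extClass.precompOfLinear R K (add_comm 1 0)).comp
        ((isRelDual_zero K).equiv C bot_le).toLinearMap
    have hδ : Function.Surjective δ :=
      (precomp_extClass_surjective hS K 0 (hG.ext_eq_zero 1 one_pos)).comp (LinearEquiv.surjective _)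
    have hδf : δ ∘ₗ dualMap K f = 0 := by
      ext φ
      have h1 : extMap K 0 (sesOf f g hfg).f ((isRelDual_zero K).equiv G bot_le φ) =
          (isRelDual_zero K).equiv C bot_le (dualMap K f φ) :=
        (isRelDual_zero K).equiv_naturality (A := C) (B := G) bot_le bot_le (ModuleCat.ofHom f) φ
      change hS.extClass.precompOfLinear R K (add_comm 1 0)
        ((isRelDual_zero K).equiv C bot_le (dualMap K f φ)) = 0
      rw [← h1, ← LinearMap.mem_ker, ker_precomp_extClass hS]
      exact ⟨_, rfl⟩
    -- Evaluation at C* turns u ∘ δ into a class in Ext^s(L, C**), and C** ≅ C.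
    obtain ⟨ξ, hξ⟩ := (extEval_bijective L K s hL (dual K C) hC.ext_dual_eq_zero).2 (u ∘ₗ δ)
    have hξf : ξ.comp (Ext.mk₀ (ModuleCat.ofHom (dualMap K (A := dual K G) (B := dual K C)
        (dualMap K f)))) (add_zero s) = 0 := by
      refine (extEval_bijective L K s hL (dual K G) hG.ext_dual_eq_zero).1 ?_
      rw [extEval_naturality, hξ, map_zero, LinearMap.comp_assoc, hδf, LinearMap.comp_zero]
    have hnat : ModuleCat.ofHom f ≫ hG.evalIso.hom =
        hC.evalIso.hom ≫ ModuleCat.ofHom (dualMap K (A := dual K G) (B := dual K C)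
          (dualMap K f)) := rfl
    have hξ₀ : ξ.comp (Ext.mk₀ hC.evalIso.inv) (add_zero s) = 0 := by
      refine ext_postcomp_injective hS L s (fun j hj => hLM j (by omega)) _ ?_
      change (ξ.comp (Ext.mk₀ hC.evalIso.inv) (add_zero s)).comp (Ext.mk₀ (ModuleCat.ofHom f))
        (add_zero s) = 0
      have hinv : hC.evalIso.inv ≫ ModuleCat.ofHom f =
          ModuleCat.ofHom (dualMap K (A := dual K G) (B := dual K C) (dualMap K f)) ≫
            hG.evalIso.inv := by
        rw [Iso.inv_comp_eq, ← Category.assoc, ← hnat, Category.assoc, Iso.hom_inv_id,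
          Category.comp_id]
      rw [Ext.comp_assoc_of_third_deg_zero, Ext.mk₀_comp_mk₀, hinv, ← Ext.mk₀_comp_mk₀,
        ← Ext.comp_assoc_of_third_deg_zero, hξf, Ext.zero_comp]
    have hξ' : ξ = 0 := by
      rw [← Ext.comp_mk₀_id ξ, ← Iso.inv_hom_id hC.evalIso, ← Ext.mk₀_comp_mk₀,
        ← Ext.comp_assoc_of_third_deg_zero, hξ₀, Ext.zero_comp]
    rw [hξ', map_zero] at hξ
    ext x
    obtain ⟨y, rfl⟩ := hδ x
    exact congr($hξ.symm y)
  | succ t ih =>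
    obtain ⟨C, G, f, g, hfg, hS, hG, hC⟩ := h
    let e := extShift hS K (t + 1) (hG.ext_eq_zero _ (Nat.succ_pos _))
      (hG.ext_eq_zero _ (Nat.succ_pos _))
    have := ih hC (fun i hi => by
      cases i with
      | zero =>
        exact ext_zero_subsingleton_of_injective L f hS.moduleCat_injective_f
          (hG.ext_subsingleton L s hL 0 (by omega))
      | succ i =>
        exact ext_succ_subsingleton_X₁ hS L i (hLM i (by omega))
          (hG.ext_subsingleton L s hL (i + 1) (by omega))) (u ∘ₗ e.toLinearMap)
    ext x
    obtain ⟨y, rfl⟩ := e.surjective x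
    exact congr($this y)

end ModuleLinkage

namespace ModuleLinkage

variable {R : Type u} [CommRing R]

/-! ### Grade, depth and dimension over Cohen-Macaulay local rings -/

theorem ext_subsingleton_of_lt_grade {M : ModuleCat.{u} R} {n : ℕ} (h : grade M = n) (i : ℕ)
    (hi : i < n) : Subsingleton (Ext M (ModuleCat.of R R) i) := by
  by_contra hcon
  rw [not_subsingleton_iff_nontrivial] at hcon
  have : grade M ≤ i := iInf₂_le (f := fun (i : ℕ)
    (_ : Nontrivial (Ext M (ModuleCat.of R R) i)) => (i : ℕ∞)) i hcon
  rw [h] at this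
  norm_cast at this
  omega

theorem nontrivial_ext_of_grade_eq {M : ModuleCat.{u} R} {n : ℕ} (h : grade M = n) :
    Nontrivial (Ext M (ModuleCat.of R R) n) := by
  by_contra hcon
  have : ((n + 1 : ℕ) : ℕ∞) ≤ grade M := by
    refine le_iInf₂ fun i hi => ?_
    have h₁ : grade M ≤ i := iInf₂_le (f := fun (i : ℕ)
      (_ : Nontrivial (Ext M (ModuleCat.of R R) i)) => (i : ℕ∞)) i hi
    rw [h] at h₁
    have h₂ : n ≤ i := by exact_mod_cast h₁
    have h₃ : i ≠ n := by rintro rfl; exact hcon hi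
    exact_mod_cast (by omega : n + 1 ≤ i)
  rw [h] at this
  norm_cast at this
  omega

theorem nontrivial_of_grade_eq {M : ModuleCat.{u} R} {n : ℕ} (h : grade M = n) :
    Nontrivial M := by
  by_contra hcon
  rw [not_nontrivial_iff_subsingleton] at hcon
  have := nontrivial_ext_of_grade_eq h
  exact not_subsingleton _ (ext_subsingleton_of_subsingleton_left M (ModuleCat.of R R) n)

variable [IsCohenMacaulayLocalRing R]

variable (R) in
theorem exists_ringKrullDim_eq : ∃ d : ℕ, ringKrullDim R = d := by
  have h₁ : ringKrullDim R ≠ ⊥ := ringKrullDim_ne_bot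
  have h₂ : ringKrullDim R ≠ ⊤ := (ringKrullDim_lt_top (R := R)).ne
  obtain ⟨D, hD⟩ := WithBot.ne_bot_iff_exists.1 h₁
  rw [← hD] at h₂ ⊢
  obtain ⟨d, hd⟩ := ENat.ne_top_iff_exists.1 (fun h => h₂ (by rw [h]; rfl) : D ≠ ⊤)
  exact ⟨d, by rw [← hd]; rfl⟩

variable {d : ℕ} (hd : ringKrullDim R = d)
include hd

theorem depth_ring_eq : depth (ModuleCat.of R R) = d := by
  have := IsCohenMacaulayLocalRing.depth_eq_dim (R := R)
  rw [hd] at this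
  exact_mod_cast this

theorem depth_le_of_supportDim_add_le (M : ModuleCat.{u} R) [Module.Finite R M] [Nontrivial M]
    (t : ℕ) (h : Module.supportDim R M + t ≤ ringKrullDim R) : depth M + t ≤ d := by
  have := (add_le_add_left (depth_le_supportDim M) (t : WithBot ℕ∞)).trans h
  rw [hd] at this
  exact_mod_cast this

theorem IsSemidualizing.ext_residue_subsingleton {K : ModuleCat.{u} R} (hK : IsSemidualizing K)
    (i : ℕ) (hi : i < d) : Subsingleton (Ext (residue R) K i) :=
  hK.ext_subsingleton (residue R) d
    ((le_depth_iff (ModuleCat.of R R) d).1 (depth_ring_eq hd).ge) i hi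

theorem depth_add_le_of_ext_subsingleton (M : ModuleCat.{u} R) [Module.Finite R M] [Nontrivial M]
    (t : ℕ) (h : ∀ i < t, Subsingleton (Ext M (ModuleCat.of R R) i)) : depth M + t ≤ d :=
  depth_le_of_supportDim_add_le hd M t (supportDim_add_le M t h)

/-- One inequality holds over any Noetherian local ring. For the other, Ischebeck's theorem with
depth R = d would kill Ext^n(M, R) if dim M + n < d. -/
theorem supportDim_add_grade_eq (M : ModuleCat.{u} R) [Module.Finite R M] {n : ℕ}
    (h : grade M = n) : ∃ D : ℕ, Module.supportDim R M = D ∧ D + n = d := by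
  have := nontrivial_of_grade_eq h
  have hle := supportDim_add_le M n (ext_subsingleton_of_lt_grade h)
  have hbot := Module.supportDim_ne_bot_of_nontrivial R M
  obtain ⟨D', hD'⟩ := WithBot.ne_bot_iff_exists.1 hbot
  rw [← hD', hd] at hle
  have hle' : D' + n ≤ d := by exact_mod_cast hle
  have hne : D' ≠ ⊤ := by rintro rfl; simp at hle'
  obtain ⟨D, rfl⟩ := ENat.ne_top_iff_exists.1 hne
  have hle'' : D + n ≤ d := by exact_mod_cast hle'
  refine ⟨D, hD'.symm, le_antisymm hle'' (not_lt.1 fun hlt => ?_)⟩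
  have hext := nontrivial_ext_of_grade_eq h
  refine not_subsingleton _ (ext_subsingleton_of_add_supportDim_lt (ModuleCat.of R R) d
    ((le_depth_iff (ModuleCat.of R R) d).1 (depth_ring_eq hd).ge) D M hD'.symm.le n (by omega))

/-- The **Auslander-Bridger formula**. -/
theorem IsSemidualizing.depth_add_gkDim_eq {K : ModuleCat.{u} R} (hK : IsSemidualizing K)
    (M : ModuleCat.{u} R) [Module.Finite R M] [Nontrivial M] {t : ℕ} (h : gkDim K M = t) :
    depth M + t = d := by
  have := hK.finite
  have hres := hK.ext_residue_subsingleton hd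
  have hgk := gkLe_of_gkDim_eq h
  have hlow : ∀ i, i + t < d → Subsingleton (Ext (residue R) M i) :=
    hgk.ext_right_subsingleton (residue R) d hres
  have hup : depth M ≤ d := by
    simpa using depth_add_le_of_ext_subsingleton hd M 0 (by simp)
  cases t with
  | zero =>
    have := (le_depth_iff M d).2 fun i hi => hlow i (by omega)
    simpa using le_antisymm hup this
  | succ t =>
    have hE := not_subsingleton_ext_of_gkDim_eq h
    -- Otherwise there is no nonzero map from the top Ext of M to Ext^d(k, K), with k the residue
    -- field. Some element annihilating the top Ext is then regular on Ext^d(k, K); it lies in the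
    -- maximal ideal, which kills that module. So Ext^d(k, K) = 0, and the depth of K would exceed
    -- d.
    have hex : ¬ ∀ i, i + (t + 1) ≤ d → Subsingleton (Ext (residue R) M i) := by
      intro hall
      have hsub : Subsingleton (Ext M K (t + 1) →ₗ[R] Ext (residue R) K d) :=
        subsingleton_of_forall_eq 0
          (hgk.linearMap_ext_eq_zero (residue R) d hres t hall)
      obtain ⟨r, hr, hreg⟩ := IsSMulRegular.subsingleton_linearMap_iff.1 hsub
      have hrm : r ∈ Module.annihilator R (residue R) := by
        rw [residue_annihilator]
        refine IsLocalRing.le_maximalIdeal (fun htop => hE ?_) hr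
        exact Module.annihilator_eq_top_iff.1 htop
      have hV : Subsingleton (Ext (residue R) K d) := ⟨fun a b => hreg (by
        simp only [ext_smul_eq_zero_of_mem_annihilator_left hrm])⟩
      have hdK : ((d + 1 : ℕ) : ℕ∞) ≤ depth K := (le_depth_iff K _).2 fun i hi => by
        rcases Nat.lt_succ_iff_lt_or_eq.1 hi with h' | rfl
        · exact hres i h'
        · exact hV
      have hKnt : Nontrivial K := by
        by_contra hcon
        rw [not_nontrivial_iff_subsingleton] at hcon
        have h0 := hK.annihilator_eq_bot
        rw [Module.annihilator_eq_top_iff.2 hcon] at h0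
        exact top_ne_bot h0
      have hle : depth K + (0 : ℕ) ≤ d := depth_add_le_of_ext_subsingleton hd K 0 (by simp)
      have := hdK.trans (by simpa using hle)
      norm_cast at this
      omega
    push Not at hex
    obtain ⟨i, hi, hnon⟩ := hex
    have hid : i + (t + 1) = d := by
      by_contra hne
      exact not_subsingleton_iff_nontrivial.2 hnon (hlow i (by omega))
    have : depth M = i := (depth_eq_iff M i).2
      ⟨fun j hj => hlow j (by omega), not_subsingleton_iff_nontrivial.2 hnon⟩
    rw [this, ← hid]
    norm_cast

/-- `depth Ext^t(M, K) ≤ dim R - t` if `t` is the `G_K`-dimension of `M`. -/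
theorem IsSemidualizing.depth_ext_gkDim_add_le {K : ModuleCat.{u} R} (hK : IsSemidualizing K)
    (M : ModuleCat.{u} R) [Module.Finite R M] {t : ℕ} (h : gkDim K M = (t + 1 : ℕ)) :
    depth (ModuleCat.of R (Ext M K (t + 1))) + (t + 1 : ℕ) ≤ d := by
  have := hK.finite
  have hgk := gkLe_of_gkDim_eq h
  let E := ModuleCat.of R (Ext M K (t + 1))
  have : Nontrivial E := not_subsingleton_iff_nontrivial.1 (not_subsingleton_ext_of_gkDim_eq h)
  -- For L = E and s = i < t + 1 the condition on Ext(E, M) is empty, so Hom(E, Ext^i(E, K)) = 0. An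
  -- element annihilating E is then both regular and zero on Ext^i(E, K).
  have hE : ∀ i < t + 1, Subsingleton (Ext E K i) := by
    intro i hi
    induction i using Nat.strong_induction_on with
    | _ i ih =>
      have hsub : Subsingleton (Ext M K (t + 1) →ₗ[R] Ext E K i) :=
        subsingleton_of_forall_eq 0 (hgk.linearMap_ext_eq_zero E i
          (fun j hj => ih j hj (hj.trans hi)) t fun j hj => by omega)
      obtain ⟨r, hr, hreg⟩ := IsSMulRegular.subsingleton_linearMap_iff.1 hsub
      exact ⟨fun a b => hreg (by
        simp only [ext_smul_eq_zero_of_mem_annihilator_left (A := E) hr])⟩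
  exact depth_add_le_of_ext_subsingleton hd E (t + 1) (hK.ext_ring_subsingleton E (t + 1) hE)

end ModuleLinkage

open RingTheory.Sequence


namespace ModuleLinkage

variable {R : Type u} [CommRing R]

/-! ### Relative dualizing modules from regular sequences -/

theorem ext_quotSMulTop_right_subsingleton (L K : ModuleCat.{u} R) {r : R}
    (hr : IsSMulRegular K r) (i : ℕ) (h₀ : Subsingleton (Ext L K i))
    (h₁ : Subsingleton (Ext L K (i + 1))) :
    Subsingleton (Ext L (ModuleCat.of R (QuotSMulTop r K)) i) :=
  ext_subsingleton_X₃ hr.smulShortComplex_shortExact L i h₀ h₁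

theorem exists_isWeaklyRegular_of_ext_subsingleton [IsNoetherianRing R] (L : ModuleCat.{u} R)
    [Module.Finite R L] (n : ℕ) (A B : ModuleCat.{u} R) [Module.Finite R A] [Module.Finite R B]
    (hA : ∀ i < n, Subsingleton (Ext L A i)) (hB : ∀ i < n, Subsingleton (Ext L B i)) :
    ∃ rs : List R, rs.length = n ∧ Ideal.ofList rs ≤ Module.annihilator R L ∧
      IsWeaklyRegular A rs ∧ IsWeaklyRegular B rs := by
  induction n generalizing A B with
  | zero => exact ⟨[], rfl, by simp, .nil R A, .nil R B⟩
  | succ n ih =>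
    have h₁ := (ext_zero_subsingleton_iff L A).1 (hA 0 (Nat.succ_pos n))
    have h₂ := (ext_zero_subsingleton_iff L B).1 (hB 0 (Nat.succ_pos n))
    -- Working with the product gives one element of the annihilator that is regular on A and B
    -- simultaneously.
    have h₃ : Subsingleton (L →ₗ[R] A × B) := (LinearMap.prodEquiv R).symm.subsingleton
    obtain ⟨r, hr, hreg⟩ := IsSMulRegular.subsingleton_linearMap_iff.1 h₃
    have hrA : IsSMulRegular A r := fun a a' h => congrArg Prod.fst
      (@hreg (a, 0) (a', 0) (Prod.ext h rfl))
    have hrB : IsSMulRegular B r := fun b b' h => congrArg Prod.snd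
      (@hreg (0, b) (0, b') (Prod.ext rfl h))
    obtain ⟨rs, hlen, hann, hrsA, hrsB⟩ := ih (ModuleCat.of R (QuotSMulTop r A))
      (ModuleCat.of R (QuotSMulTop r B))
      (fun i hi => ext_quotSMulTop_right_subsingleton L A hrA i (hA i (by omega))
        (hA (i + 1) (by omega)))
      (fun i hi => ext_quotSMulTop_right_subsingleton L B hrB i (hB i (by omega))
        (hB (i + 1) (by omega)))
    refine ⟨r :: rs, by simp [hlen], ?_, IsWeaklyRegular.cons hrA hrsA,
      IsWeaklyRegular.cons hrB hrsB⟩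
    rw [Ideal.ofList_cons]
    exact sup_le ((Ideal.span_singleton_le_iff_mem _).2 hr) hann

/-- Each regular element raises the bound on nonvanishing Ext by one. For P = R this supplies the
last condition of `IsRelDual`. -/
theorem ext_quotient_ofList_subsingleton (K : ModuleCat.{u} R) (rs : List R) (p : ℕ)
    (P : ModuleCat.{u} R) (hrs : IsWeaklyRegular P rs)
    (hP : ∀ i, p < i → Subsingleton (Ext P K i)) (i : ℕ) (hi : p + rs.length < i) :
    Subsingleton (Ext (ModuleCat.of R (P ⧸ (Ideal.ofList rs • ⊤ : Submodule R P))) K i) := by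
  induction rs generalizing p P i with
  | nil =>
    refine ext_subsingleton_of_iso_left (B := P) (LinearEquiv.toModuleIso ?_) K i
      (hP i (by simpa using hi))
    exact Submodule.quotEquivOfEqBot _ (by simp)
  | cons r rs ih =>
    rw [isWeaklyRegular_cons_iff] at hrs
    refine ext_subsingleton_of_iso_left (LinearEquiv.toModuleIso
      (Submodule.quotOfListConsSMulTopEquivQuotSMulTopInner P r rs)) K i
      (ih (p + 1) (ModuleCat.of R (QuotSMulTop r P)) hrs.2 (fun j hj => ?_) i (by
        rw [List.length_cons] at hi; omega))
    obtain ⟨j, rfl⟩ := Nat.exists_eq_succ_of_ne_zero (Nat.ne_zero_of_lt hj)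
    exact ext_succ_left_subsingleton_X₃ hrs.1.smulShortComplex_shortExact K j (hP j (by omega))
      (hP (j + 1) (by omega))

/-- K' is the iterated quotient of K by `rs`, and θ is the Yoneda product of the extension classes
of 0 → K → K → K/rK → 0. The inclusion of annihilators serves the induction: it shows that r, which
kills K/rK, also kills K'. -/
theorem exists_ext_representation (rs : List R) (K : ModuleCat.{u} R) [Module.Finite R K]
    (hrs : IsWeaklyRegular K rs) :
    ∃ (K' : ModuleCat.{u} R) (θ : Ext K' K rs.length), Module.Finite R K' ∧
      Module.annihilator R K ≤ Module.annihilator R K' ∧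
      Ideal.ofList rs ≤ Module.annihilator R K' ∧
      (∀ W : ModuleCat.{u} R, Ideal.ofList rs ≤ Module.annihilator R W →
        (∀ i < rs.length, Subsingleton (Ext W K i)) ∧
        Function.Bijective (fun f : W →ₗ[R] K' =>
          (Ext.mk₀ (ModuleCat.ofHom f)).comp θ (zero_add rs.length))) ∧
      ∀ (L : ModuleCat.{u} R) (s : ℕ), (∀ i < s + rs.length, Subsingleton (Ext L K i)) →
        ∀ i < s, Subsingleton (Ext L K' i) := by
  induction rs generalizing K with
  | nil =>
    have h := isRelDual_zero K
    exact ⟨K, Ext.mk₀ (𝟙 K), inferInstance, le_rfl, by simp, fun W _ =>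
      ⟨fun i hi => absurd hi (Nat.not_lt_zero i), h.bijective W bot_le⟩, fun L s hL => hL⟩
  | cons r rs ih =>
    rw [isWeaklyRegular_cons_iff] at hrs
    obtain ⟨K', θ, hfin, hann, hJ, hW, hL⟩ := ih (ModuleCat.of R (QuotSMulTop r K)) hrs.2
    have hS := hrs.1.smulShortComplex_shortExact (M := K)
    have hr : r ∈ Module.annihilator R (QuotSMulTop r K) := QuotSMulTop.mem_annihilator K r
    refine ⟨K', θ.comp hS.extClass rfl, hfin, ?_, ?_, fun W hJW => ?_, fun L s hLs => ?_⟩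
    · refine le_trans ?_ hann
      exact LinearMap.annihilator_le_of_surjective (Submodule.mkQ _) (Submodule.mkQ_surjective _)
    · rw [Ideal.ofList_cons]
      exact sup_le ((Ideal.span_singleton_le_iff_mem _).2 (hann hr)) hJ
    · rw [Ideal.ofList_cons, sup_le_iff, Ideal.span_singleton_le_iff_mem] at hJW
      obtain ⟨hrW, hJW⟩ := hJW
      obtain ⟨hvan, hbij⟩ := hW W hJW
      -- Since r kills W, multiplication by r is zero on Ext(W, K), and the long exact sequence
      -- breaks into short pieces. In degree `rs.length` the connecting map Ext(W, K/rK) → Ext(W, K)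
      -- is therefore bijective.
      have hzero : ∀ (i : ℕ) (x : Ext W K i),
          x.comp (Ext.mk₀ (K.smulShortComplex r).f) (add_zero i) = 0 := fun i x =>
        (comp_mk₀_smul_id r i x).trans (ext_smul_eq_zero_of_mem_annihilator_left hrW i x)
      have hvan' : ∀ i < rs.length + 1, Subsingleton (Ext W K i) := fun i hi =>
        subsingleton_of_forall_eq 0 fun x => ext_postcomp_injective hS W i
          (fun j hj => hvan j (by omega)) x (hzero i x)
      refine ⟨hvan', ?_⟩
      have hcomp : (fun f : W →ₗ[R] K' =>
          (Ext.mk₀ (ModuleCat.ofHom f)).comp (θ.comp hS.extClass rfl)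
            (zero_add (rs.length + 1))) =
          (fun x => x.comp hS.extClass rfl) ∘ fun f : W →ₗ[R] K' =>
            (Ext.mk₀ (ModuleCat.ofHom f)).comp θ (zero_add rs.length) := by
        funext f
        exact (Ext.comp_assoc _ _ _ _ _ (by omega)).symm
      change Function.Bijective (fun f : W →ₗ[R] K' =>
          (Ext.mk₀ (ModuleCat.ofHom f)).comp (θ.comp hS.extClass rfl)
            (zero_add (rs.length + 1)))
      rw [hcomp]
      refine Function.Bijective.comp ⟨(injective_iff_map_eq_zero
        (hS.extClass.postcomp W (a := rs.length) rfl)).2 fun x h0 => ?_, fun x => ?_⟩ hbij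
      · obtain ⟨z, rfl⟩ := Ext.covariant_sequence_exact₃ W hS x rfl h0
        have : Subsingleton (Ext W (K.smulShortComplex r).X₂ rs.length) :=
          hvan' _ (Nat.lt_succ_self _)
        rw [Subsingleton.elim z 0, Ext.zero_comp]
      · exact Ext.covariant_sequence_exact₁ W hS x (hzero _ x) rfl
    · rw [List.length_cons] at hLs
      exact hL L s fun i hi => ext_quotSMulTop_right_subsingleton L K hrs.1 i (hLs i (by omega))
        (hLs (i + 1) (by omega))

/-- If `Ext^i(L, R)` and `Ext^i(L, K)` vanish for `i < n`, then there is a relative dualizing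
module for the modules that are killed by some ideal contained in the annihilator of `L`. -/
theorem exists_isRelDual [IsNoetherianRing R] (K L : ModuleCat.{u} R) [Module.Finite R K]
    [Module.Finite R L] (n : ℕ) (hK : ∀ i < n, Subsingleton (Ext L K i))
    (hR : ∀ i < n, Subsingleton (Ext L (ModuleCat.of R R) i)) :
    ∃ (J : Ideal R) (K' : ModuleCat.{u} R) (θ : Ext K' K n), J ≤ Module.annihilator R L ∧
      IsRelDual J n K K' θ ∧
      ∀ (L' : ModuleCat.{u} R) (s : ℕ), (∀ i < s + n, Subsingleton (Ext L' K i)) →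
        ∀ i < s, Subsingleton (Ext L' K' i) := by
  obtain ⟨rs, rfl, hann, hrsK, hrsR⟩ := exists_isWeaklyRegular_of_ext_subsingleton L n K
    (ModuleCat.of R R) hK hR
  obtain ⟨K', θ, hfin, -, hJ, hW, hL⟩ := exists_ext_representation rs K hrsK
  refine ⟨Ideal.ofList rs, K', θ, hann, ⟨hfin, hJ, fun W h => (hW W h).1, fun W h => (hW W h).2,
    fun i hi => ?_⟩, hL⟩
  have : Projective (ModuleCat.of R R) := ModuleCat.projective_of_free (ι := Unit)
    (Module.Basis.singleton Unit R)
  refine ext_subsingleton_of_iso_left (LinearEquiv.toModuleIso (Submodule.quotEquivOfEq _ _ ?_)) K i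
    (ext_quotient_ofList_subsingleton K rs 0 (ModuleCat.of R R) hrsR (fun j hj => ?_) i (by omega))
  · exact (Ideal.mul_top _).symm
  · obtain ⟨j, rfl⟩ := Nat.exists_eq_succ_of_ne_zero hj.ne'
    exact Ext.subsingleton_of_projective _ K j

end ModuleLinkage

namespace ModuleLinkage

variable {R : Type u} [CommRing R]

/-! ### The depth of the image of a dual map -/

/-- The sequence `0 → im f → B → coker f → 0`. -/
theorem range_shortExact {A B : ModuleCat.{u} R} (f : A →ₗ[R] B) :
    (sesOf (A := ModuleCat.of R (LinearMap.range f)) (B := B)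
      (C := ModuleCat.of R (B ⧸ LinearMap.range f)) (LinearMap.range f).subtype
      (LinearMap.range f).mkQ (LinearMap.exact_subtype_mkQ _)).ShortExact :=
  sesOf_shortExact _ _ _ (Submodule.subtype_injective _) (Submodule.mkQ_surjective _)

/-- The sequence `0 → Hom(X₃, K) → Hom(X₂, K) → im → 0`. -/
theorem dual_range_shortExact (K : ModuleCat.{u} R) {S : ShortComplex (ModuleCat.{u} R)}
    (hS : S.ShortExact) : ∃ h, (sesOf (A := dual K S.X₃) (B := dual K S.X₂)
      (C := ModuleCat.of R (LinearMap.range (dualMap K S.f.hom))) (dualMap K S.g.hom)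
      (dualMap K S.f.hom).rangeRestrict h).ShortExact := by
  have h := dualMap_exact K S.f.hom S.g.hom (exact_of_shortExact hS) hS.moduleCat_surjective_g
  refine ⟨fun x => ?_, sesOf_shortExact _ _ _
    (dualMap_injective K S.g.hom hS.moduleCat_surjective_g) (LinearMap.surjective_rangeRestrict _)⟩
  rw [← h x]
  exact Subtype.ext_iff

variable [IsNoetherianRing R] {J : Ideal R} {n : ℕ} {K K' : ModuleCat.{u} R} {θ : Ext K' K n}

theorem IsRelDual.ext_X₁_subsingleton (h : IsRelDual J n K K' θ)
    {S : ShortComplex (ModuleCat.{u} R)} (hS : S.ShortExact) [Module.Finite R S.X₂]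
    (hJ : J ≤ Module.annihilator R S.X₂) (L : ModuleCat.{u} R) (b : ℕ)
    (hb : ∀ i < b, Subsingleton (Ext L K' i))
    (hX : ∀ i, n < i → Subsingleton (Ext S.X₂ K i))
    (hW : ∀ i, n + 1 < i → Subsingleton (Ext S.X₃ K i)) :
    ∀ i < b, Subsingleton (Ext L (dual K' S.X₁) i) := by
  have := finite_X₁ hS
  refine fun i hi => h.ext_dual_subsingleton L b hb i hi S.X₁ (le_annihilator_X₁ hS hJ)
    fun j hj => ?_
  exact ext_left_subsingleton_X₁ hS K j (hX j hj) (hW (j + 1) (by omega))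

/-- If `Hom(X₂, K') → Hom(X₁, K')` is surjective, its image is `Hom(X₁, K')`. -/
noncomputable def rangeDualMapIso {S : ShortComplex (ModuleCat.{u} R)}
    (hsurj : Function.Surjective (dualMap K' S.f.hom)) :
    ModuleCat.of R (LinearMap.range (dualMap K' S.f.hom)) ≅ dual K' S.X₁ :=
  (LinearEquiv.ofTop _ (LinearMap.range_eq_top.2 hsurj)).toModuleIso

theorem IsRelDual.ext_range_dualMap_subsingleton (h : IsRelDual J n K K' θ)
    {S : ShortComplex (ModuleCat.{u} R)} (hS : S.ShortExact) [Module.Finite R S.X₂]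
    (hJ : J ≤ Module.annihilator R S.X₂) (L : ModuleCat.{u} R) (b : ℕ)
    (hb : ∀ i < b, Subsingleton (Ext L K' i))
    (hX : ∀ i, n < i → Subsingleton (Ext S.X₂ K i))
    (hW : ∀ i, n < i → Subsingleton (Ext S.X₃ K i)) (i : ℕ) (hi : i < b) :
    Subsingleton (Ext L (ModuleCat.of R (LinearMap.range (dualMap K' S.f.hom))) i) :=
  ext_subsingleton_of_iso_right (rangeDualMapIso (h.dualMap_surjective hS
    (le_annihilator_X₁ hS hJ) hJ (hW _ (Nat.lt_succ_self n)))) L i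
    (h.ext_X₁_subsingleton hS hJ L b hb hX (fun i hi => hW i (by omega)) i hi)

/-- For j = 0 the image sits in X₁*, of depth at least b, with cokernel Ext^{n+1}(X₃, K), so its
depth is one more. For larger j the dual map is onto, so the image is X₁*; passing to a syzygy of X₁
over R/J lowers j by one and the depth by one. The bound by b makes every depth comparison exact. -/
theorem IsRelDual.depth_range_dualMap [IsLocalRing R] (h : IsRelDual J n K K' θ)
    [Module.Finite R K] (b : ℕ) (hb : ∀ i < b, Subsingleton (Ext (residue R) K' i)) (j : ℕ)
    {S : ShortComplex (ModuleCat.{u} R)} (hS : S.ShortExact) [Module.Finite R S.X₂]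
    (hJ : J ≤ Module.annihilator R S.X₂)
    (hX : ∀ i, n < i → Subsingleton (Ext S.X₂ K i))
    (hW : ∀ i, n < i → i ≠ n + j + 1 → Subsingleton (Ext S.X₃ K i))
    (hd : depth (ModuleCat.of R (Ext S.X₃ K (n + j + 1))) + (j + 1 : ℕ) ≤ b) :
    depth (ModuleCat.of R (LinearMap.range (dualMap K' S.f.hom))) =
      depth (ModuleCat.of R (Ext S.X₃ K (n + j + 1))) + (j + 1 : ℕ) := by
  have := h.finite
  induction j generalizing S with
  | zero =>
    have := finite_X₁ hS
    have := finite_X₃ hS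
    have hJ₁ := le_annihilator_X₁ hS hJ
    let e : ModuleCat.of R (dual K' S.X₁ ⧸ LinearMap.range (dualMap K' S.f.hom)) ≅
        ModuleCat.of R (Ext S.X₃ K (n + 1)) :=
      (h.cokernelEquiv hS hJ₁ hJ (hX _ (Nat.lt_succ_self n))).toModuleIso
    have hfin : Module.Finite R (dual K' S.X₁ ⧸ LinearMap.range (dualMap K' S.f.hom)) :=
      inferInstance
    have he := depth_eq_of_iso e
    have hE := h.ext_X₁_subsingleton hS hJ (residue R) b hb hX
      (fun i hi => hW i (by omega) (by omega))
    have hS' := range_shortExact (dualMap K' S.f.hom)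
    have h₁ : Module.Finite R (LinearMap.range (dualMap K' S.f.hom)) := inferInstance
    change depth (ModuleCat.of R (Ext S.X₃ K (n + 1))) + 1 ≤ b at hd
    change _ = depth (ModuleCat.of R (Ext S.X₃ K (n + 1))) + 1
    rw [← he] at hd ⊢
    have h₁' : Module.Finite R (sesOf (A := ModuleCat.of R (LinearMap.range (dualMap K' S.f.hom)))
      (B := dual K' S.X₁) (C := ModuleCat.of R (_ ⧸ LinearMap.range (dualMap K' S.f.hom)))
      (LinearMap.range (dualMap K' S.f.hom)).subtype
      (LinearMap.range (dualMap K' S.f.hom)).mkQ (LinearMap.exact_subtype_mkQ _)).X₁ := h₁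
    have h₃' : Module.Finite R (sesOf (A := ModuleCat.of R (LinearMap.range (dualMap K' S.f.hom)))
      (B := dual K' S.X₁) (C := ModuleCat.of R (_ ⧸ LinearMap.range (dualMap K' S.f.hom)))
      (LinearMap.range (dualMap K' S.f.hom)).subtype
      (LinearMap.range (dualMap K' S.f.hom)).mkQ (LinearMap.exact_subtype_mkQ _)).X₃ := hfin
    exact depth_X₁_eq hS' b hE hd
  | succ j ih =>
    have := finite_X₁ hS
    have := finite_X₃ hS
    have hJ₁ := le_annihilator_X₁ hS hJ
    have hsurj := h.dualMap_surjective hS hJ₁ hJ (hW _ (by omega) (by omega))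
    -- In 0 → W → (R/J)^c → X₁ → 0 the cokernel X₁ has its only remaining Ext one degree lower than
    -- X₃, so the induction hypothesis applies.
    obtain ⟨c, W, _, f, g, hfg, hT⟩ := exists_cover S.X₁ hJ₁
    let e : ModuleCat.of R (Ext S.X₁ K (n + j + 1)) ≅
        ModuleCat.of R (Ext S.X₃ K (n + (j + 1) + 1)) :=
      (extShift hS K (n + j + 1) (hX _ (by omega)) (hX _ (by omega))).toModuleIso
    have he := depth_eq_of_iso e
    rw [← he] at hd ⊢
    have hTfin : Module.Finite R (sesOf f g hfg).X₂ :=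
      inferInstanceAs (Module.Finite R (Fin c → R ⧸ J))
    have hTJ : J ≤ Module.annihilator R (sesOf f g hfg).X₂ := pi_quotient_annihilator J c
    have hlt : depth (ModuleCat.of R (Ext S.X₁ K (n + j + 1))) + (j + 1 : ℕ) + 1 ≤ b := by
      refine le_trans (le_of_eq ?_) hd
      push_cast
      ring
    have hI := ih hT hTJ (h.ext_pi_quotient c) (fun i hi hne =>
      ext_left_subsingleton_X₁ hS K i (hX i hi) (hW (i + 1) (by omega) (by omega)))
      (le_trans le_self_add hlt)
    rw [depth_eq_of_iso (rangeDualMapIso hsurj)]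
    obtain ⟨hex, hD⟩ := dual_range_shortExact K' hT
    have hdepth := @depth_X₁_eq R _ _ _ _ hD
      (inferInstanceAs (Module.Finite R (S.X₁ →ₗ[R] K')))
      (inferInstanceAs (Module.Finite R (LinearMap.range (dualMap K' (sesOf f g hfg).f.hom)))) b
      (fun i hi => h.ext_dual_pi_quotient (residue R) c i (hb i hi))
      (hI.symm ▸ hlt)
    refine hdepth.trans ?_
    change depth (ModuleCat.of R (LinearMap.range (dualMap K' (sesOf f g hfg).f.hom))) + 1 = _
    rw [hI]
    change depth (ModuleCat.of R (Ext S.X₁ K (n + j + 1))) + (j + 1 : ℕ) + 1 = _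
    push_cast
    ring

end ModuleLinkage

namespace ModuleLinkage

variable {R : Type u} [CommRing R]

/-! ### Biduality and linkage -/

/-- A dual is a retract of its bidual, so evaluation has a left inverse ρ : X** → X. The two
isomorphisms also give an abstract X ≅ X**. Composed with it, ρ is a surjective endomorphism of a
Noetherian module, hence injective. -/
theorem bijective_eval_of_equiv_dual {K X Y : ModuleCat.{u} R} [IsNoetherian R X]
    (α : X ≃ₗ[R] dual K Y) (β : Y ≃ₗ[R] dual K X) :
    Function.Bijective ((LinearMap.id : (X →ₗ[R] K) →ₗ[R] (X →ₗ[R] K)).flip) := by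
  let ev : X →ₗ[R] ((X →ₗ[R] K) →ₗ[R] K) :=
    (LinearMap.id : (X →ₗ[R] K) →ₗ[R] (X →ₗ[R] K)).flip
  let ρ : ((X →ₗ[R] K) →ₗ[R] K) →ₗ[R] X :=
    α.symm.toLinearMap ∘ₗ LinearMap.lcomp R K (α.toLinearMap : X →ₗ[R] (Y →ₗ[R] K)).flip
  have hρ : ∀ x, ρ (ev x) = x := fun x => α.injective (by
    change α (α.symm _) = _
    rw [LinearEquiv.apply_symm_apply]
    rfl)
  let σ : X ≃ₗ[R] ((X →ₗ[R] K) →ₗ[R] K) := α.trans (LinearEquiv.congrLeft K R β)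
  have hρs : Function.Surjective ρ := fun x => ⟨ev x, hρ x⟩
  have hinj : Function.Injective (ρ ∘ₗ σ.toLinearMap) :=
    IsNoetherian.injective_of_surjective_endomorphism _ (by
      rw [LinearMap.coe_comp]; exact hρs.comp σ.surjective)
  have hρi : Function.Injective ρ := fun a b hab => by
    obtain ⟨a, rfl⟩ := σ.surjective a
    obtain ⟨b, rfl⟩ := σ.surjective b
    exact congrArg σ (hinj hab)
  exact ⟨fun a b hab => by rw [← hρ a, ← hρ b]; exact congrArg ρ hab,
    fun Ψ => ⟨ρ Ψ, hρi (hρ (ρ Ψ))⟩⟩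

/-- If `X₂` is reflexive and `X₃` is torsionless, then `X₁` is the dual of the image of
`Hom(X₂, K) → Hom(X₁, K)`. -/
theorem exists_equiv_dual_range {K : ModuleCat.{u} R} {S : ShortComplex (ModuleCat.{u} R)}
    (hS : S.ShortExact)
    (h₂ : Function.Bijective ((LinearMap.id : (S.X₂ →ₗ[R] K) →ₗ[R] (S.X₂ →ₗ[R] K)).flip))
    (h₃ : ∀ m : S.X₃, (∀ f : S.X₃ →ₗ[R] K, f m = 0) → m = 0) :
    ∃ e : S.X₁ ≃ₗ[R] (LinearMap.range (dualMap K S.f.hom) →ₗ[R] K),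
      ∀ z w, e z w = (w : S.X₁ →ₗ[R] K) z := by
  obtain ⟨hinj, hsurj⟩ := bijective_eval_iff.1 h₂
  let e : S.X₁ →ₗ[R] (LinearMap.range (dualMap K S.f.hom) →ₗ[R] K) :=
    (LinearMap.range (dualMap K S.f.hom)).subtype.flip
  refine ⟨LinearEquiv.ofBijective e ⟨?_, fun Ψ => ?_⟩, fun z w => rfl⟩
  · rw [injective_iff_map_eq_zero]
    intro z hz
    refine hS.moduleCat_injective_f ((hinj _ fun f => ?_).trans (map_zero S.f.hom).symm)
    exact congr($hz ⟨dualMap K S.f.hom f, f, rfl⟩)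
  · obtain ⟨x, hx⟩ := hsurj (Ψ ∘ₗ (dualMap K S.f.hom).rangeRestrict)
    have hgx : S.g.hom x = 0 := h₃ _ fun f => by
      refine (hx (dualMap K S.g.hom f)).symm.trans ?_
      have h0 : (dualMap K S.f.hom).rangeRestrict (dualMap K S.g.hom f) = 0 :=
        Subtype.ext ((dualMap_exact K S.f.hom S.g.hom (exact_of_shortExact hS)
          hS.moduleCat_surjective_g).apply_apply_eq_zero f)
      rw [LinearMap.comp_apply, h0, map_zero]
    obtain ⟨z, rfl⟩ := (exact_of_shortExact hS x).1 hgx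
    refine ⟨z, ?_⟩
    ext ⟨_, f, rfl⟩
    exact (hx f).symm

/-- The cokernel of the evaluation map of `N` into its bidual. -/
abbrev BidualCokernel (K N : ModuleCat.{u} R) : Type u :=
  ((N →ₗ[R] K) →ₗ[R] K) ⧸
    LinearMap.range ((LinearMap.id : (N →ₗ[R] K) →ₗ[R] (N →ₗ[R] K)).flip)

theorem nonempty_bidualCokernel_equiv (K : ModuleCat.{u} R) {A B : ModuleCat.{u} R}
    (e : A ≃ₗ[R] B) : Nonempty (BidualCokernel K A ≃ₗ[R] BidualCokernel K B) := by
  let E : ((A →ₗ[R] K) →ₗ[R] K) ≃ₗ[R] ((B →ₗ[R] K) →ₗ[R] K) :=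
    LinearEquiv.congrLeft K R (LinearEquiv.congrLeft K R e)
  refine ⟨Submodule.Quotient.equiv _ _ E ?_⟩
  ext Ψ
  constructor
  · rintro ⟨_, ⟨a, rfl⟩, rfl⟩
    exact ⟨e a, rfl⟩
  · rintro ⟨b, rfl⟩
    refine ⟨_, ⟨e.symm b, rfl⟩, ?_⟩
    ext φ
    change φ (e (e.symm b)) = φ b
    rw [LinearEquiv.apply_symm_apply]

/-- Dualizing `e` identifies X₁* with the bidual of the image. The formula for `e` says that the
inclusion of the image into X₁* becomes the evaluation map. -/
theorem nonempty_quotient_range_equiv_bidualCokernel {K : ModuleCat.{u} R}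
    {S : ShortComplex (ModuleCat.{u} R)}
    (e : S.X₁ ≃ₗ[R] (LinearMap.range (dualMap K S.f.hom) →ₗ[R] K))
    (he : ∀ z w, e z w = (w : S.X₁ →ₗ[R] K) z) :
    Nonempty ((dual K S.X₁ ⧸ LinearMap.range (dualMap K S.f.hom)) ≃ₗ[R]
      BidualCokernel K (ModuleCat.of R (LinearMap.range (dualMap K S.f.hom)))) := by
  refine ⟨Submodule.Quotient.equiv _ _ (LinearEquiv.congrLeft K R e) ?_⟩
  have key : ∀ w : LinearMap.range (dualMap K S.f.hom), LinearEquiv.congrLeft K R e w.1 =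
      (LinearMap.id : ((LinearMap.range (dualMap K S.f.hom)) →ₗ[R] K) →ₗ[R] _).flip w := by
    intro w
    ext Ψ
    obtain ⟨z, rfl⟩ := e.surjective Ψ
    change w.1 (e.symm (e z)) = e z w
    rw [LinearEquiv.symm_apply_apply, he]
  ext Ψ
  constructor
  · rintro ⟨w, hw, rfl⟩
    exact ⟨⟨w, hw⟩, (key ⟨w, hw⟩).symm⟩
  · rintro ⟨w, rfl⟩
    exact ⟨w.1, w.2, key w⟩

/-- The exact sequence `0 → ker φ → X → M → 0`. -/
abbrev kerSequence {X M : ModuleCat.{u} R} (φ : X ⟶ M) : ShortComplex (ModuleCat.{u} R) :=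
  sesOf (A := ModuleCat.of R (LinearMap.ker φ.hom)) (LinearMap.ker φ.hom).subtype φ.hom
    (LinearMap.exact_subtype_ker_map _)

theorem kerSequence_shortExact {X M : ModuleCat.{u} R} {φ : X ⟶ M}
    (h : Function.Surjective φ.hom) : (kerSequence φ).ShortExact :=
  sesOf_shortExact _ _ _ (Submodule.subtype_injective _) h

theorem gkPerfect_ext_subsingleton {K X : ModuleCat.{u} R} {n : ℕ} (h : gkPerfect K n X) (i : ℕ)
    (hi : n < i) : Subsingleton (Ext X K i) :=
  (gkLe_of_gkDim_eq (h.2.2.trans h.2.1)).ext_subsingleton i hi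

/-! ### One direct link read through relative duality -/

section Link

variable {J : Ideal R} {n : ℕ} {K K' : ModuleCat.{u} R} {θ : Ext K' K n}

theorem IsRelDual.nonempty_equiv_range (h : IsRelDual J n K K' θ) {X M Y N : ModuleCat.{u} R}
    {φ : X ⟶ M} {ψ : Y ⟶ N} (hφ : Function.Surjective φ.hom) (hJ : J ≤ Module.annihilator R X)
    (hψ : HomEquivalent ψ (linkHom K n φ)) :
    Nonempty (N ≃ₗ[R] LinearMap.range (dualMap K' (kerSequence φ).f.hom)) ∧
      Nonempty (Y ≃ₗ[R] dual K' X) := by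
  obtain ⟨α, β, -⟩ := hψ
  have hS := kerSequence_shortExact hφ
  have hmap := h.map_range (le_annihilator_X₁ hS hJ) hJ (kerSequence φ).f
  let e : LinearMap.range (dualMap K' (kerSequence φ).f.hom) ≃ₗ[R]
      LinearMap.range (extKer K n φ) :=
    ((h.equiv _ (le_annihilator_X₁ hS hJ)).submoduleMap _).trans (LinearEquiv.ofEq _ _ hmap)
  exact ⟨⟨α.toLinearEquiv.trans e.symm⟩, ⟨β.toLinearEquiv.trans (h.equiv X hJ).symm⟩⟩

variable [IsNoetherianRing R]

/-- The kernel of φ is identified with Hom(N, K'), so the right-hand sides involve only N, and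
neither X nor φ. This independence is what makes two consecutive links comparable. -/
theorem IsRelDual.link_equiv (h : IsRelDual J n K K' θ) {X M Y N : ModuleCat.{u} R}
    {φ : X ⟶ M} {ψ : Y ⟶ N} (hφ : IsReflexiveHom (gkPerfect K n) φ)
    (hψ : IsReflexiveHom (gkPerfect K n) ψ) (h₁ : HomEquivalent φ (linkHom K n ψ))
    (h₂ : HomEquivalent ψ (linkHom K n φ)) (hX : J ≤ Module.annihilator R X)
    (hY : J ≤ Module.annihilator R Y) :
    Nonempty (Ext M K (n + 1) ≃ₗ[R] BidualCokernel K' N) ∧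
      ∀ i, n < i → Nonempty (Ext M K (i + 1) ≃ₗ[R] Ext (dual K' N) K i) := by
  have := hφ.prop_source.1
  have := h.finite
  obtain ⟨⟨eN⟩, ⟨β⟩⟩ := h.nonempty_equiv_range hφ.surjective hX h₂
  obtain ⟨⟨eM⟩, ⟨α⟩⟩ := h.nonempty_equiv_range hψ.surjective hY h₁
  have hS := kerSequence_shortExact hφ.surjective
  have hrefl := bijective_eval_of_equiv_dual α β
  -- By the link, M is isomorphic to a submodule of a K'-dual, so maps to K' separate its elements.
  have htors : ∀ m : M, (∀ f : M →ₗ[R] K', f m = 0) → m = 0 := by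
    intro m hm
    refine eM.injective (Subtype.ext (LinearMap.ext fun w => ?_))
    rw [map_zero]
    exact hm ((LinearMap.applyₗ w : dual K' (kerSequence ψ).X₁ →ₗ[R] K') ∘ₗ
      (LinearMap.range (dualMap K' (kerSequence ψ).f.hom)).subtype ∘ₗ eM.toLinearMap)
  have hext := gkPerfect_ext_subsingleton hφ.prop_source
  obtain ⟨e, he⟩ := exists_equiv_dual_range hS hrefl htors
  obtain ⟨q⟩ := nonempty_quotient_range_equiv_bidualCokernel e he
  obtain ⟨q'⟩ := nonempty_bidualCokernel_equiv K' (A := N)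
    (B := ModuleCat.of R (LinearMap.range (dualMap K' (kerSequence φ).f.hom))) eN
  refine ⟨⟨(h.cokernelEquiv hS (le_annihilator_X₁ hS hX) hX (hext _ (Nat.lt_succ_self n))).symm.trans
    (q.trans q'.symm)⟩, fun i hi => ?_⟩
  let E : (kerSequence φ).X₁ ≅ dual K' N :=
    (e.trans (LinearEquiv.congrLeft K' R eN.symm)).toModuleIso
  exact ⟨(extShift hS K i (hext i hi) (hext (i + 1) (by omega))).symm.trans (extCongrLeft E K i)⟩

end Link

/-! ### Invariance of the higher Ext modules under even linkage -/

theorem DirectlyLinked.symm {K M N : ModuleCat.{u} R} {n : ℕ}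
    {𝒳 : ObjectProperty (ModuleCat.{u} R)} (h : DirectlyLinked K n 𝒳 M N) :
    DirectlyLinked K n 𝒳 N M := by
  obtain ⟨X, Y, φ, ψ, h₁, h₂, h₃, h₄⟩ := h
  exact ⟨Y, X, ψ, φ, h₂, h₁, h₄, h₃⟩

variable [IsNoetherianRing R]

theorem IsSemidualizing.nonempty_ext_equiv {K : ModuleCat.{u} R} (hK : IsSemidualizing K) {n : ℕ}
    {M N M' : ModuleCat.{u} R} (h₁ : DirectlyLinked K n (gkPerfect K n) M N)
    (h₂ : DirectlyLinked K n (gkPerfect K n) N M') (i : ℕ) (hi : n < i) :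
    Nonempty (Ext M K i ≃ₗ[R] Ext M' K i) := by
  obtain ⟨X, Y, φ, ψ, hφ, hψ, hφψ, hψφ⟩ := h₁
  obtain ⟨X', Y', φ', ψ', hφ', hψ', hφψ', hψφ'⟩ := h₂.symm
  have := hK.finite
  have := hφ.prop_source.1
  have := hψ.prop_source.1
  have := hφ'.prop_source.1
  have := hψ'.prop_source.1
  -- The product of all four modules gives a single J killing each of them. Both links are then
  -- computed with the same K'.
  let L := ModuleCat.of R ((X × Y) × (X' × Y'))
  have hR : ∀ i < n, Subsingleton (Ext L (ModuleCat.of R R) i) := fun i hi =>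
    ext_prod_left_subsingleton (ModuleCat.of R (X × Y)) (ModuleCat.of R (X' × Y')) _ i
      (ext_prod_left_subsingleton X Y _ i (ext_subsingleton_of_lt_grade hφ.prop_source.2.1 i hi)
        (ext_subsingleton_of_lt_grade hψ.prop_source.2.1 i hi))
      (ext_prod_left_subsingleton X' Y' _ i (ext_subsingleton_of_lt_grade hφ'.prop_source.2.1 i hi)
        (ext_subsingleton_of_lt_grade hψ'.prop_source.2.1 i hi))
  obtain ⟨J, K', θ, hJ, h, -⟩ := exists_isRelDual K L n (hK.ext_subsingleton L n hR) hR
  have hX : J ≤ Module.annihilator R X := hJ.trans (LinearMap.annihilator_le_of_surjective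
    (LinearMap.fst R X Y ∘ₗ LinearMap.fst R (X × Y) (X' × Y'))
    (fun x => ⟨((x, 0), 0), rfl⟩))
  have hY : J ≤ Module.annihilator R Y := hJ.trans (LinearMap.annihilator_le_of_surjective
    (LinearMap.snd R X Y ∘ₗ LinearMap.fst R (X × Y) (X' × Y'))
    (fun x => ⟨((0, x), 0), rfl⟩))
  have hX' : J ≤ Module.annihilator R X' := hJ.trans (LinearMap.annihilator_le_of_surjective
    (LinearMap.fst R X' Y' ∘ₗ LinearMap.snd R (X × Y) (X' × Y'))
    (fun x => ⟨(0, (x, 0)), rfl⟩))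
  have hY' : J ≤ Module.annihilator R Y' := hJ.trans (LinearMap.annihilator_le_of_surjective
    (LinearMap.snd R X' Y' ∘ₗ LinearMap.snd R (X × Y) (X' × Y'))
    (fun x => ⟨(0, (0, x)), rfl⟩))
  obtain ⟨⟨a⟩, b⟩ := h.link_equiv hφ hψ hφψ hψφ hX hY
  obtain ⟨⟨a'⟩, b'⟩ := h.link_equiv hφ' hψ' hφψ' hψφ' hX' hY'
  obtain ⟨i, rfl⟩ := Nat.exists_eq_succ_of_ne_zero (Nat.ne_zero_of_lt hi)
  rcases Nat.lt_succ_iff_lt_or_eq.1 hi with hi' | rfl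
  · obtain ⟨c⟩ := b i hi'
    obtain ⟨c'⟩ := b' i hi'
    exact ⟨c.trans c'.symm⟩
  · exact ⟨a.trans a'.symm⟩

theorem IsSemidualizing.nonempty_ext_equiv_of_linkedInSteps {K : ModuleCat.{u} R}
    (hK : IsSemidualizing K) {n : ℕ} (c : ℕ → ModuleCat.{u} R) (k : ℕ)
    (hc : ∀ i < 2 * k, DirectlyLinked K n (gkPerfect K n) (c i) (c (i + 1))) (i : ℕ) (hi : n < i) :
    Nonempty (Ext (c 0) K i ≃ₗ[R] Ext (c (2 * k)) K i) := by
  induction k with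
  | zero => exact ⟨LinearEquiv.refl R _⟩
  | succ k ih =>
    obtain ⟨e⟩ := ih fun i hi => hc i (by omega)
    obtain ⟨e'⟩ := hK.nonempty_ext_equiv (hc (2 * k) (by omega)) (hc (2 * k + 1) (by omega)) i hi
    exact ⟨e.trans e'⟩

end ModuleLinkage

namespace ModuleLinkage

variable {R : Type u} [CommRing R]

/-! ### Depth of linked modules -/

theorem nontrivial_ext_of_gkDim_eq {K : ModuleCat.{u} R} [Module.Finite R K] {M : ModuleCat.{u} R}
    [Nontrivial M] {t : ℕ} (h : gkDim K M = t) : Nontrivial (Ext M K t) := by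
  cases t with
  | succ t => exact not_subsingleton_iff_nontrivial.1 (not_subsingleton_ext_of_gkDim_eq h)
  | zero =>
    by_contra hE
    rw [not_nontrivial_iff_subsingleton] at hE
    have hT : IsTotallyReflexive K M := gkLe_of_gkDim_eq h
    obtain ⟨m, hm⟩ := exists_ne (0 : M)
    -- In degree 0, M embeds in its bidual, so a nonzero M has a nonzero map to K.
    refine hm ((bijective_eval_iff.1 hT.bijective_eval).1 m fun f => ?_)
    have h0 : ModuleCat.ofHom f = 0 :=
      (Ext.homEquiv₀ (X := M) (Y := K)).symm.injective (Subsingleton.elim _ _)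
    exact congr($(congrArg ModuleCat.Hom.hom h0) m)

theorem DirectlyLinked.grade_left {K M N : ModuleCat.{u} R} {n : ℕ}
    (h : DirectlyLinked K n (gkPerfect K n) M N) : grade M = n := by
  obtain ⟨X, Y, φ, ψ, hφ, -⟩ := h
  exact hφ.grade_eq.trans hφ.prop_source.2.1

theorem DirectlyLinked.finite_left {K M N : ModuleCat.{u} R} {n : ℕ}
    (h : DirectlyLinked K n (gkPerfect K n) M N) : Module.Finite R M := by
  obtain ⟨X, Y, φ, ψ, hφ, -⟩ := h
  exact hφ.finite_target

variable [IsCohenMacaulayLocalRing R] {d : ℕ}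

theorem nat_le_of_depth_add_le {M : ModuleCat.{u} R} {b n d : ℕ} (h : depth M + (n : ℕ∞) ≤ d)
    (hb : b + n = d) : depth M ≤ b := by
  rw [← hb, Nat.cast_add] at h
  exact (ENat.add_le_add_iff_right (ENat.natCast_ne_top n)).1 h

theorem IsSemidualizing.exists_isRelDual (hd : ringKrullDim R = d) {K : ModuleCat.{u} R}
    (hK : IsSemidualizing K) {n b : ℕ} (hb : b + n = d) (X : ModuleCat.{u} R) [Module.Finite R X]
    (hX : grade X = n) :
    ∃ (J : Ideal R) (K' : ModuleCat.{u} R) (θ : Ext K' K n), J ≤ Module.annihilator R X ∧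
      IsRelDual J n K K' θ ∧ ∀ i < b, Subsingleton (Ext (residue R) K' i) := by
  have := hK.finite
  have hR := ext_subsingleton_of_lt_grade hX
  obtain ⟨J, K', θ, hJ, h, hs⟩ := ModuleLinkage.exists_isRelDual K X n (hK.ext_subsingleton X n hR) hR
  exact ⟨J, K', θ, hJ, h, hs _ b fun i hi => hK.ext_residue_subsingleton hd i (hb ▸ hi)⟩

/-- Relative duality gives Ext^n(M, K) ≅ Hom(M, K'), of depth at least b because the higher Ext^i(M,
K) vanish. The upper bound comes from the depth estimate for the top Ext, or from dim R when n = 0.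
-/
theorem IsSemidualizing.depth_ext_gkDim_eq (hd : ringKrullDim R = d) {K : ModuleCat.{u} R}
    (hK : IsSemidualizing K) {n b : ℕ} (hb : b + n = d) (M : ModuleCat.{u} R) [Module.Finite R M]
    (hM : grade M = n) (ht : gkDim K M = n) : depth (ModuleCat.of R (Ext M K n)) = b := by
  have := hK.finite
  have := nontrivial_of_grade_eq hM
  apply le_antisymm
  · refine nat_le_of_depth_add_le ?_ hb
    cases n with
    | succ n => exact hK.depth_ext_gkDim_add_le hd M ht
    | zero =>
      have := nontrivial_ext_of_gkDim_eq ht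
      exact depth_add_le_of_ext_subsingleton hd (ModuleCat.of R (Ext M K 0)) 0
        fun i hi => absurd hi (Nat.not_lt_zero i)
  · obtain ⟨J, K', θ, hJ, h, hK'⟩ := hK.exists_isRelDual hd hb M hM
    rw [le_depth_iff]
    intro i hi
    have := h.ext_dual_subsingleton (residue R) b hK' i hi M hJ
      ((gkLe_of_gkDim_eq ht).ext_subsingleton)
    exact ext_subsingleton_of_iso_right (h.equiv M hJ).symm.toModuleIso _ _ this

/-- Here N is the full dual Hom(ker φ, K'), which has depth at least b; its grade prevents more. -/
theorem IsSemidualizing.depth_eq_of_directlyLinked (hd : ringKrullDim R = d) {K : ModuleCat.{u} R}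
    (hK : IsSemidualizing K) {n b : ℕ} (hb : b + n = d) {M N : ModuleCat.{u} R}
    (hMN : DirectlyLinked K n (gkPerfect K n) M N)
    (hM : ∀ i, n < i → Subsingleton (Ext M K i)) : depth N = b := by
  have hN := hMN.symm.grade_left
  have := hMN.symm.finite_left
  have := nontrivial_of_grade_eq hN
  obtain ⟨X, Y, φ, ψ, hφ, hψ, hφψ, hψφ⟩ := hMN
  have := hK.finite
  have : Module.Finite R (kerSequence φ).X₂ := hφ.prop_source.1
  have : Module.Finite R X := this
  obtain ⟨J, K', θ, hJ, h, hK'⟩ := hK.exists_isRelDual hd hb X hφ.prop_source.2.1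
  obtain ⟨⟨e⟩, -⟩ := h.nonempty_equiv_range hφ.surjective hJ hψφ
  refine le_antisymm (nat_le_of_depth_add_le (depth_add_le_of_ext_subsingleton hd N n
    (ext_subsingleton_of_lt_grade hN)) hb) ((le_depth_iff N b).2 fun i hi => ?_)
  have := h.ext_range_dualMap_subsingleton (kerSequence_shortExact hφ.surjective) hJ (residue R) b
    hK' (gkPerfect_ext_subsingleton hφ.prop_source) hM i hi
  exact ext_subsingleton_of_iso_right (LinearEquiv.toModuleIso e) _ _ this

theorem IsSemidualizing.depth_eq_depth_ext_add_of_directlyLinked (hd : ringKrullDim R = d)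
    {K : ModuleCat.{u} R} (hK : IsSemidualizing K) {n b : ℕ} (hb : b + n = d)
    {M N : ModuleCat.{u} R} (hMN : DirectlyLinked K n (gkPerfect K n) M N) (j : ℕ)
    (hM : ∀ i, n < i → i ≠ n + j + 1 → Subsingleton (Ext M K i))
    (hE : depth (ModuleCat.of R (Ext M K (n + j + 1))) + (j + 1 : ℕ) ≤ b) :
    depth N = depth (ModuleCat.of R (Ext M K (n + j + 1))) + (j + 1 : ℕ) := by
  have := hMN.symm.finite_left
  obtain ⟨X, Y, φ, ψ, hφ, hψ, hφψ, hψφ⟩ := hMN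
  have := hK.finite
  have : Module.Finite R (kerSequence φ).X₂ := hφ.prop_source.1
  have : Module.Finite R X := this
  obtain ⟨J, K', θ, hJ, h, hK'⟩ := hK.exists_isRelDual hd hb X hφ.prop_source.2.1
  obtain ⟨⟨e⟩, -⟩ := h.nonempty_equiv_range hφ.surjective hJ hψφ
  have := Module.Finite.equiv e
  exact (depth_eq_of_iso (LinearEquiv.toModuleIso e)).trans
    (h.depth_range_dualMap b hK' j (kerSequence_shortExact hφ.surjective) hJ
      (gkPerfect_ext_subsingleton hφ.prop_source) hM hE)

end ModuleLinkage

/-! ### The depth formula for odd linkage -/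

theorem mainTheorem9 {R : Type u} [CommRing R] [ModuleLinkage.IsCohenMacaulayLocalRing R]
    (K : ModuleCat.{u} R) (hK : ModuleLinkage.IsSemidualizing K) (n : ℕ)
    (M N : ModuleCat.{u} R) [Module.Finite R M] [Module.Finite R N]
    (m : ℕ) (hm : Odd m)
    (hMN : ModuleLinkage.LinkedInSteps K n (ModuleLinkage.gkPerfect K n) m M N)
    (hM : ModuleLinkage.IsReducedGKPerfect K M) :
    ((ModuleLinkage.depth M + ModuleLinkage.depth N : ℕ∞) : WithBot ℕ∞) =
      Module.supportDim R M +
        ((ModuleLinkage.depth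
          (ModuleCat.of R (CategoryTheory.Abelian.Ext M K (ModuleLinkage.gkDim K M).toNat)) : ℕ∞) :
          WithBot ℕ∞) := by
  obtain ⟨k, rfl⟩ := hm
  obtain ⟨c, rfl, rfl, hc⟩ := hMN
  have := hK.finite
  obtain ⟨d, hd⟩ := ModuleLinkage.exists_ringKrullDim_eq R
  have hgrade : ModuleLinkage.grade (c 0) = n := (hc 0 (by omega)).grade_left
  have := ModuleLinkage.nontrivial_of_grade_eq hgrade
  obtain ⟨b, hdim, hb⟩ := ModuleLinkage.supportDim_add_grade_eq hd (c 0) hgrade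
  obtain ⟨t, ht⟩ := ENat.ne_top_iff_exists.1 hM.gkDim_ne_top
  have hdepth := hK.depth_add_gkDim_eq hd (c 0) ht.symm
  have hlink := hc (2 * k) (by omega)
  have hfin := hlink.finite_left
  have hequiv := hK.nonempty_ext_equiv_of_linkedInSteps c k fun i hi => hc i (by omega)
  have hred : ∀ i, n < i → i ≠ t → Subsingleton (Ext (c (2 * k)) K i) := fun i hi hit => by
    obtain ⟨e⟩ := hequiv i hi
    have := hM.ext_eq_zero i (by rw [hgrade]; exact_mod_cast hi.ne')
      (by rw [← ht]; exact_mod_cast hit)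
    exact e.symm.injective.subsingleton
  -- Since depth M = d - t cannot exceed dim M = d - n.
  have hnt : n ≤ t := by
    have h := ModuleLinkage.depth_le_supportDim (c 0)
    rw [hdim] at h
    have h' : ModuleLinkage.depth (c 0) ≤ (b : ℕ∞) := by exact_mod_cast h
    obtain ⟨a, ha⟩ := ENat.ne_top_iff_exists.1 (ne_top_of_le_ne_top (ENat.natCast_ne_top b) h')
    rw [← ha] at h' hdepth
    norm_cast at h' hdepth
    omega
  have htn : (ModuleLinkage.gkDim K (c 0)).toNat = t := by rw [← ht, ENat.toNat_natCast]
  rw [hdim, htn]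
  -- The invariance of Ext under even linkage starts above degree n, so t = n is treated directly:
  -- all four terms of the formula equal b.
  rcases hnt.eq_or_lt with rfl | hlt
  · rw [hK.depth_ext_gkDim_eq hd hb _ hgrade ht.symm,
      hK.depth_eq_of_directlyLinked hd hb hlink fun i hi => hred i hi hi.ne']
    have hb' : ModuleLinkage.depth (c 0) = b := by
      obtain ⟨a, ha⟩ := ENat.ne_top_iff_exists.1
        (ne_top_of_le_ne_top (ENat.natCast_ne_top d) (le_self_add.trans hdepth.le))
      rw [← ha] at hdepth ⊢
      norm_cast at hdepth ⊢
      omega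
    rw [hb']
    norm_cast
  · obtain ⟨j, rfl⟩ := Nat.exists_eq_add_of_lt hlt
    -- This bound is the input required by the depth formula for the last link, after transport
    -- along the isomorphism of Ext modules.
    have hle := hK.depth_ext_gkDim_add_le hd (c 0) ht.symm
    obtain ⟨e⟩ := hequiv (n + j + 1) hlt
    have hE := ModuleLinkage.depth_eq_of_iso (A := ModuleCat.of R (Ext (c 0) K (n + j + 1)))
      (B := ModuleCat.of R (Ext (c (2 * k)) K (n + j + 1))) e.toModuleIso
    obtain ⟨q, hq⟩ := ENat.ne_top_iff_exists.1
      (ne_top_of_le_ne_top (ENat.natCast_ne_top d) (le_self_add.trans hle))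
    obtain ⟨a, ha⟩ := ENat.ne_top_iff_exists.1
      (ne_top_of_le_ne_top (ENat.natCast_ne_top d) (le_self_add.trans hdepth.le))
    have hq' := hE.symm.trans hq.symm
    rw [← hq] at hle
    norm_cast at hle
    rw [hK.depth_eq_depth_ext_add_of_directlyLinked hd hb hlink j hred
      (by rw [hq']; norm_cast; omega), hq', ← hq, ← ha]
    rw [← ha] at hdepth
    norm_cast at hdepth ⊢
    omega
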